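/- Let $\mathbb O\simeq\mathbb R^8$ be the octonions with their standard inner product $\langle\,,\rangle$, let $L_{\mathbf x}$, $R_{\mathbf x}$ denote left and right multiplication by $\mathbf x\in\mathbb O$, and let $C$ be the conjugation $C\mathbf x=2\langle\mathbf x,\mathbf 1\rangle\mathbf 1-\mathbf x$. Realize $\mathrm{Spin}(8)$ as the group of triples $(g_1,g_2,g_3)\in \mathrm{SO}(\mathbb O)^3$ such that $g_2(\mathbf x\mathbf y)=g_1(\mathbf x)\,g_3(\mathbf y)$ for all $\mathbf x,\mathbf y\in\mathbb O$, and write an element of its Lie algebra $\mathfrak{spin}(8)$ as $a=(a_1,a_2,a_3)$. Let $\mathrm{Spin}(9,1)$ denote the connected spin group of signature $(9,1)$, that is, the double cover, inside the Clifford algebra, of the identity component of $\mathrm{SO}(9,1)$. Consider $$ \mathfrak{spin}(9,1)=\left\{\begin{pmatrix} a_1+r\,I_8 & C\,R_{\mathbf w}\\ C\,L_{\mathbf x} & a_3-r\,I_8\end{pmatrix}\ \middle|\ r\in\mathbb R,\ \mathbf w,\mathbf x\in\mathbb O,\ a\in\mathfrak{spin}(8)\right\}\subset \mathrm{End}_{\mathbb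 R}(\mathbb O^2). $$ Then: 1. $\mathfrak{spin}(9,1)$ is a Lie subalgebra of $\mathfrak{sl}(\mathbb O^2)\simeq\mathfrak{sl}(16,\mathbb R)$. 2. There is a faithful (continuous) representation $\rho:\mathrm{Spin}(9,1)\to\mathrm{GL}(\mathbb O^2)\simeq\mathrm{GL}(16,\mathbb R)$ for which the Lie algebra of the group $\rho(\mathrm{Spin}(9,1))$ is $\mathfrak{spin}(9,1)$. 3. For every such $\rho$, the action of $\mathrm{Spin}(9,1)$ on $\mathbb O^2\simeq\mathbb R^{16}$ has exactly two orbits: $\{0\}$ and the set of all nonzero vectors. -/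

import Mathlib

open scoped Quaternion

noncomputable section

/-! ### The octonions -/

/-- The octonions, by the Cayley-Dickson doubling of Hamilton's quaternions.  The `ℓ²` product
carries the standard positive definite inner product of `ℝ⁸`. -/
def Octonion : Type := WithLp 2 (ℍ[ℝ] × ℍ[ℝ])

namespace Octonion

instance : NormedAddCommGroup Octonion :=
  inferInstanceAs (NormedAddCommGroup (WithLp 2 (ℍ[ℝ] × ℍ[ℝ])))

instance : InnerProductSpace ℝ Octonion :=
  inferInstanceAs (InnerProductSpace ℝ (WithLp 2 (ℍ[ℝ] × ℍ[ℝ])))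

instance : FiniteDimensional ℝ Octonion :=
  (WithLp.linearEquiv 2 ℝ (ℍ[ℝ] × ℍ[ℝ])).symm.finiteDimensional

/-- The octonion with quaternionic components `a` and `b`. -/
def mk (a b : ℍ[ℝ]) : Octonion := WithLp.toLp 2 (a, b)

/-- The first quaternionic component. -/
def fst (x : Octonion) : ℍ[ℝ] := (WithLp.ofLp (p := 2) (V := ℍ[ℝ] × ℍ[ℝ]) x).1

/-- The second quaternionic component. -/
def snd (x : Octonion) : ℍ[ℝ] := (WithLp.ofLp (p := 2) (V := ℍ[ℝ] × ℍ[ℝ]) x).2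

theorem ext_components {x y : Octonion} (h₁ : x.fst = y.fst) (h₂ : x.snd = y.snd) : x = y :=
  congrArg (WithLp.toLp 2) (Prod.ext h₁ h₂)

instance : One Octonion := ⟨mk 1 0⟩

/-- The Cayley-Dickson product `(a, b)(c, d) = (a c - d̄ b, d a + b c̄)`. -/
instance : Mul Octonion :=
  ⟨fun x y => mk (x.fst * y.fst - star y.snd * x.snd) (y.snd * x.fst + x.snd * star y.fst)⟩

theorem fst_add (x y : Octonion) : (x + y).fst = x.fst + y.fst := rfl
theorem snd_add (x y : Octonion) : (x + y).snd = x.snd + y.snd := rfl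
theorem fst_smul (r : ℝ) (x : Octonion) : (r • x).fst = r • x.fst := rfl
theorem snd_smul (r : ℝ) (x : Octonion) : (r • x).snd = r • x.snd := rfl

theorem fst_mul (x y : Octonion) :
    (x * y).fst = x.fst * y.fst - star y.snd * x.snd := rfl

theorem snd_mul (x y : Octonion) :
    (x * y).snd = y.snd * x.fst + x.snd * star y.fst := rfl

theorem add_mul' (x y z : Octonion) : (x + y) * z = x * z + y * z := by
  apply ext_components
  · simp only [fst_mul, fst_add, snd_add]; noncomm_ring
  · simp only [snd_mul, fst_add, snd_add]; noncomm_ring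

theorem mul_add' (x y z : Octonion) : x * (y + z) = x * y + x * z := by
  apply ext_components
  · simp only [fst_mul, fst_add, snd_add, star_add]; noncomm_ring
  · simp only [snd_mul, fst_add, snd_add, star_add]; noncomm_ring

theorem smul_mul' (r : ℝ) (x y : Octonion) : (r • x) * y = r • (x * y) := by
  apply ext_components
  · simp only [fst_mul, fst_smul, snd_smul, smul_sub, smul_mul_assoc, mul_smul_comm]
  · simp only [snd_mul, fst_smul, snd_smul, smul_add, smul_mul_assoc, mul_smul_comm]

theorem mul_smul' (r : ℝ) (x y : Octonion) : x * (r • y) = r • (x * y) := by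
  apply ext_components
  · simp only [fst_mul, fst_smul, snd_smul, smul_sub, smul_mul_assoc, mul_smul_comm,
      Quaternion.star_smul]
  · simp only [snd_mul, fst_smul, snd_smul, smul_add, smul_mul_assoc, mul_smul_comm,
      Quaternion.star_smul]

/-- Left multiplication `L_x`. -/
def L (x : Octonion) : Octonion →L[ℝ] Octonion :=
  LinearMap.toContinuousLinearMap
    { toFun := fun y => x * y
      map_add' := mul_add' x
      map_smul' := fun r y => mul_smul' r x y }

/-- Right multiplication `R_x`. -/
def R (x : Octonion) : Octonion →L[ℝ] Octonion :=
  LinearMap.toContinuousLinearMap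
    { toFun := fun y => y * x
      map_add' := fun y z => add_mul' y z x
      map_smul' := fun r y => smul_mul' r y x }

/-- Conjugation `C`, given by `x ↦ 2⟨x, 1⟩ 1 - x`. -/
def C : Octonion →L[ℝ] Octonion :=
  (2 : ℝ) • (innerSL ℝ (1 : Octonion)).smulRight (1 : Octonion)
    - ContinuousLinearMap.id ℝ Octonion

end Octonion

/-! ### The Lie algebra of a group of invertible elements of a real Banach algebra -/

/-- The Lie algebra of a subgroup `G` of the group of units of `𝔸` (for instance of `GL(V)`): the
elements all of whose real multiples have their exponential in `G`. -/
def lieAlgebraOf {𝔸 : Type*} [NormedRing 𝔸] [NormedAlgebra ℝ 𝔸] (G : Subgroup 𝔸ˣ) : Set 𝔸 :=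
  {A | ∀ t : ℝ, ∃ g ∈ G, (g : 𝔸) = NormedSpace.exp (t • A)}

/-! ### `Spin(8)` by triality -/

/-- Membership in the special orthogonal group `SO(𝕆) ≃ SO(8)`. -/
def IsSpecialOrthogonal (g : Octonion →L[ℝ] Octonion) : Prop :=
  (∀ x, ‖g x‖ = ‖x‖) ∧ LinearMap.det (g : Octonion →ₗ[ℝ] Octonion) = 1

/-- The algebra in which triples `(g₁, g₂, g₃)` of endomorphisms of `𝕆` live. -/
abbrev EndTriple : Type :=
  (Octonion →L[ℝ] Octonion) × (Octonion →L[ℝ] Octonion) × (Octonion →L[ℝ] Octonion)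

/-- The triples `(g₁, g₂, g₃) ∈ SO(8)³` with `g₂ (x y) = g₁ (x) g₃ (y)` for all octonions. -/
def IsTrialityTriple (g : EndTriple) : Prop :=
  IsSpecialOrthogonal g.1 ∧ IsSpecialOrthogonal g.2.1 ∧ IsSpecialOrthogonal g.2.2 ∧
    ∀ x y : Octonion, g.2.1 (x * y) = g.1 x * g.2.2 y

theorem IsSpecialOrthogonal.one : IsSpecialOrthogonal 1 :=
  ⟨fun _ => rfl, LinearMap.det_id⟩

theorem IsSpecialOrthogonal.mul {g h : Octonion →L[ℝ] Octonion}
    (hg : IsSpecialOrthogonal g) (hh : IsSpecialOrthogonal h) : IsSpecialOrthogonal (g * h) := by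
  refine ⟨fun x => (hg.1 (h x)).trans (hh.1 x), ?_⟩
  have e : ((g * h : Octonion →L[ℝ] Octonion) : Octonion →ₗ[ℝ] Octonion)
      = (g : Octonion →ₗ[ℝ] Octonion) ∘ₗ (h : Octonion →ₗ[ℝ] Octonion) := rfl
  rw [e, LinearMap.det_comp, hg.2, hh.2, one_mul]

theorem IsSpecialOrthogonal.of_mul_eq_one {g h : Octonion →L[ℝ] Octonion}
    (hg : IsSpecialOrthogonal g) (e : g * h = 1) : IsSpecialOrthogonal h := by
  refine ⟨fun x => ?_, ?_⟩
  · rw [← hg.1 (h x)]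
    exact congrArg norm (DFunLike.congr_fun e x)
  · have e' : (g : Octonion →ₗ[ℝ] Octonion) ∘ₗ (h : Octonion →ₗ[ℝ] Octonion)
        = LinearMap.id := congrArg ContinuousLinearMap.toLinearMap e
    have d := congrArg LinearMap.det e'
    rwa [LinearMap.det_comp, hg.2, one_mul, LinearMap.det_id] at d

/-- The triality model of `Spin(8)`: the group of all triality triples. -/
def Spin8 : Subgroup EndTripleˣ where
  carrier := {g | IsTrialityTriple (g : EndTriple)}
  one_mem' := ⟨.one, .one, .one, fun _ _ => rfl⟩
  mul_mem' := fun {g h} hg hh => ⟨hg.1.mul hh.1, hg.2.1.mul hh.2.1, hg.2.2.1.mul hh.2.2.1,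
    fun x y => (congrArg (g : EndTriple).2.1 (hh.2.2.2 x y)).trans (hg.2.2.2 _ _)⟩
  inv_mem' := fun {g} hg => by
    have e : (g : EndTriple) * (g⁻¹ : EndTripleˣ) = 1 := g.mul_inv
    have e' : ((g⁻¹ : EndTripleˣ) : EndTriple) * (g : EndTriple) = 1 := g.inv_mul
    have e₁ := congrArg Prod.fst e
    have e₂ := congrArg (fun p => p.2.1) e
    have e₃ := congrArg (fun p => p.2.2) e
    have e₂' := congrArg (fun p => p.2.1) e'
    refine ⟨hg.1.of_mul_eq_one e₁, hg.2.1.of_mul_eq_one e₂, hg.2.2.1.of_mul_eq_one e₃,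
      fun x y => ?_⟩
    have h := hg.2.2.2 (((g⁻¹ : EndTripleˣ) : EndTriple).1 x)
      (((g⁻¹ : EndTripleˣ) : EndTriple).2.2 y)
    have h₁ : (g : EndTriple).1 (((g⁻¹ : EndTripleˣ) : EndTriple).1 x) = x :=
      DFunLike.congr_fun e₁ x
    have h₃ : (g : EndTriple).2.2 (((g⁻¹ : EndTripleˣ) : EndTriple).2.2 y) = y :=
      DFunLike.congr_fun e₃ y
    rw [h₁, h₃] at h
    have h₂ := DFunLike.congr_fun e₂'
      (((g⁻¹ : EndTripleˣ) : EndTriple).1 x * ((g⁻¹ : EndTripleˣ) : EndTriple).2.2 y)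
    rw [← h]
    exact h₂

/-- The Lie algebra `spin(8)`, consisting of triples `a = (a₁, a₂, a₃)`. -/
def spin8 : Set EndTriple := lieAlgebraOf Spin8

/-! ### The subspace `spin(9,1)` of `End(𝕆²)` -/

/-- The sixteen-dimensional real vector space `𝕆² ≃ ℝ¹⁶`. -/
abbrev Octonion2 : Type := Octonion × Octonion

/-- The endomorphism of `𝕆²` (columns) with the block matrix `(A B; D E)`. -/
def blockEnd (A B D E : Octonion →L[ℝ] Octonion) : Octonion2 →L[ℝ] Octonion2 :=
  ((A.comp (ContinuousLinearMap.fst ℝ Octonion Octonion)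
      + B.comp (ContinuousLinearMap.snd ℝ Octonion Octonion))).prod
    (D.comp (ContinuousLinearMap.fst ℝ Octonion Octonion)
      + E.comp (ContinuousLinearMap.snd ℝ Octonion Octonion))

/-- The displayed set of block matrices
`(a₁ + r I, C R_w; C L_x, a₃ - r I)` with `r` real, `w`, `x` octonions and `a` in `spin(8)`. -/
def spin91 : Set (Octonion2 →L[ℝ] Octonion2) :=
  {M | ∃ (r : ℝ) (w x : Octonion) (a : EndTriple), a ∈ spin8 ∧
    M = blockEnd (a.1 + r • ContinuousLinearMap.id ℝ Octonion)
      (Octonion.C.comp (Octonion.R w))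
      (Octonion.C.comp (Octonion.L x))
      (a.2.2 - r • ContinuousLinearMap.id ℝ Octonion)}

/-! ### The groups `Spin(p,q)` -/

/-- The standard quadratic form of signature `(p, q)` on `ℝ^(p+q)`. -/
def signatureForm (p q : ℕ) : QuadraticForm ℝ (Fin p ⊕ Fin q → ℝ) :=
  QuadraticMap.weightedSumSquares ℝ (Sum.elim (fun _ => (1 : ℝ)) (fun _ => (-1 : ℝ)))

/-- A real Clifford algebra carries its canonical topology as a real vector space. -/
instance {V : Type*} [AddCommGroup V] [Module ℝ V] (Q : QuadraticForm ℝ V) :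
    TopologicalSpace (CliffordAlgebra Q) :=
  moduleTopology ℝ (CliffordAlgebra Q)

/-- `Spin(p,q)`: the elements `g` of the group generated by the invertible vectors of the Clifford
algebra that are even and satisfy `g gᵗ = 1`, where `t` is the reversal (which on even elements
is `star`).  For `p = 9`, `q = 1` this is the connected double cover of the identity component
of `SO(9,1)`. -/
abbrev Spin (p q : ℕ) : Type := spinGroup (signatureForm p q)

/-- `GL(𝕆²) ≃ GL(16, ℝ)`. -/
abbrev GLOctonion2 : Type := (Octonion2 →L[ℝ] Octonion2)ˣ

/-- `ρ` is a faithful (continuous) representation of `Spin(9,1)` on `𝕆²` such that the Lie algebra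
of the group of operators `ρ(Spin(9,1))` is `spin91`. -/
structure IsFaithfulRepWithLieAlgebraSpin91 (ρ : Spin 9 1 →* GLOctonion2) : Prop where
  continuous : Continuous ρ
  faithful : Function.Injective ρ
  lieAlgebra_eq : lieAlgebraOf ρ.range = spin91

end

/-!
The real Hermitian octonionic `2 × 2` matrices act on `𝕆²` by symmetric operators, and minus the
determinant is a quadratic form of signature `(9, 1)` on them. The congruences `X ↦ g X gᵀ` which
preserve these operators and the form constitute a group whose Lie algebra, computed by
differentiating this condition, is `spin(9,1)`; the diagonal blocks of its elements are controlled
by infinitesimal triality.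

A Hermitian matrix times its adjugate is its determinant, so the Hermitian matrices and their
adjugates are the two off-diagonal blocks of gamma matrices, which yields the half-spin
representation. Its image lies in the congruence group. Conversely every isometry is a product of
reflections, so its square lifts to the spin group, and the lift of the isometry induced by `g`
squared agrees with `g ^ 2` up to a sign: fourth powers of the congruence group lie in the image.
As `exp (t A)` is a fourth power, both groups have the same Lie algebra.

Finally `spin(9,1)` contains the strictly triangular blocks `C R_w` and `C L_x`, whose exponentials
are the shears `(u, v) ↦ (u + C (v w), v)` and `(u, v) ↦ (u, v + C (x u))`; since `𝕆` is a
division algebra, they already connect all nonzero vectors.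
-/

noncomputable section

attribute [local instance] LieRing.ofAssociativeRing

/-! ### One-parameter groups -/

section Exp

open NormedSpace

section BanachAlgebra

variable {𝔸 : Type*} [NormedRing 𝔸] [NormedAlgebra ℝ 𝔸]

theorem exp_eq_one_add_of_mul_self_eq_zero {N : 𝔸} (hN : N * N = 0) : exp N = 1 + N := by
  have h : ∀ n ∉ Finset.range 2, (n.factorial⁻¹ : ℝ) • N ^ n = 0 := fun n hn => by
    obtain ⟨k, rfl⟩ := Nat.exists_eq_add_of_le (not_lt.1 (Finset.mem_range.not.1 hn))
    rw [pow_add, sq, hN, zero_mul, smul_zero]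
  rw [exp_eq_tsum ℝ]
  exact (tsum_eq_sum h).trans (by simp [Finset.sum_range_succ])

variable [CompleteSpace 𝔸]

theorem exists_unit_eq_exp (a : 𝔸) : ∃ u : 𝔸ˣ, (u : 𝔸) = exp a :=
  let _ : NormedAlgebra ℚ 𝔸 := .restrictScalars ℚ ℝ 𝔸
  isUnit_exp a

theorem lieAlgebraOf_eq_of_pow_mem {G' G : Subgroup 𝔸ˣ} (hle : G' ≤ G) {n : ℕ} (hn : n ≠ 0)
    (hpow : ∀ g ∈ G, g ^ n ∈ G') : lieAlgebraOf G' = lieAlgebraOf G := by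
  let _ : NormedAlgebra ℚ 𝔸 := .restrictScalars ℚ ℝ 𝔸
  refine Set.Subset.antisymm (fun A hA t => (hA t).imp fun g hg => ⟨hle hg.1, hg.2⟩)
    fun A hA t => ?_
  obtain ⟨g, hg, hexp⟩ := hA (t / n)
  refine ⟨g ^ n, hpow g hg, ?_⟩
  rw [Units.val_pow_eq_pow_val, hexp, ← exp_nsmul, ← Nat.cast_smul_eq_nsmul ℝ, smul_smul,
    mul_div_cancel₀ t (Nat.cast_ne_zero.2 hn)]

end BanachAlgebra

theorem exp_zero_smul_apply {E : Type*} [NormedAddCommGroup E] [NormedSpace ℝ E] (a : E →L[ℝ] E)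
    (x : E) : exp ((0 : ℝ) • a) x = x := by
  simp only [zero_smul, exp_zero, one_apply_eq_self]

variable {E F G : Type*} [NormedAddCommGroup E] [NormedSpace ℝ E] [CompleteSpace E]
  [NormedAddCommGroup F] [NormedSpace ℝ F] [CompleteSpace F]
  [NormedAddCommGroup G] [NormedSpace ℝ G] [CompleteSpace G]

theorem hasDerivAt_exp_smul_apply (a : E →L[ℝ] E) (x : E) (t : ℝ) :
    HasDerivAt (fun s : ℝ => exp (s • a) x) (a (exp (t • a) x)) t := by
  simpa using (hasDerivAt_exp_smul_const' (𝕂 := ℝ) a t).clm_apply (hasDerivAt_const t x)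

theorem eq_exp_smul_apply_of_hasDerivAt {a : E →L[ℝ] E} {f : ℝ → E}
    (hf : ∀ t, HasDerivAt f (a (f t)) t) (t : ℝ) : f t = exp (t • a) (f 0) :=
  congrFun (ODE_solution_unique_univ (v := fun _ => a) (s := fun _ => Set.univ) (t₀ := 0)
    (fun _ => a.lipschitz.lipschitzOnWith) (fun t => ⟨hf t, Set.mem_univ _⟩)
    (fun t => ⟨hasDerivAt_exp_smul_apply a (f 0) t, Set.mem_univ _⟩)
    (exp_zero_smul_apply a (f 0)).symm) t

theorem map_exp_smul_apply_of_intertwine {T : E →L[ℝ] F} {a : E →L[ℝ] E} {b : F →L[ℝ] F}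
    (h : ∀ x, T (a x) = b (T x)) (t : ℝ) (x : E) : T (exp (t • a) x) = exp (t • b) (T x) := by
  have hf : ∀ s : ℝ, HasDerivAt (fun s : ℝ => T (exp (s • a) x)) (b (T (exp (s • a) x))) s :=
    fun s => h (exp (s • a) x) ▸
      T.hasFDerivAt.comp_hasDerivAt s (hasDerivAt_exp_smul_apply a x s)
  rw [eq_exp_smul_apply_of_hasDerivAt hf t, exp_zero_smul_apply]

theorem exp_smul_apply_bilin_iff (B : E →L[ℝ] F →L[ℝ] G) {a : E →L[ℝ] E} {b : F →L[ℝ] F}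
    {c : G →L[ℝ] G} :
    (∀ (t : ℝ) x y, exp (t • c) (B x y) = B (exp (t • a) x) (exp (t • b) y)) ↔
      ∀ x y, c (B x y) = B (a x) y + B x (b y) := by
  have hB : ∀ x y (t : ℝ), HasDerivAt (fun s : ℝ => B (exp (s • a) x) (exp (s • b) y))
      (B (a (exp (t • a) x)) (exp (t • b) y) + B (exp (t • a) x) (b (exp (t • b) y))) t :=
    fun x y t => add_comm (B (exp (t • a) x) _) _ ▸ B.hasDerivAt_of_bilinear
      (fun _ => hasDerivAt_exp_smul_apply a x t) (fun _ => hasDerivAt_exp_smul_apply b y t)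
  constructor
  · intro h x y
    have hd := hB x y 0
    simp only [← h, exp_zero_smul_apply] at hd
    simpa only [exp_zero_smul_apply] using (hasDerivAt_exp_smul_apply c (B x y) 0).unique hd
  · intro h t x y
    have hc : ∀ s, HasDerivAt (fun s : ℝ => B (exp (s • a) x) (exp (s • b) y))
        (c (B (exp (s • a) x) (exp (s • b) y))) s := fun s => by simpa only [h] using hB x y s
    simpa only [exp_zero_smul_apply] using (eq_exp_smul_apply_of_hasDerivAt hc t).symm

theorem bilin_exp_smul_eq_iff (B : E →L[ℝ] F →L[ℝ] G) {a : E →L[ℝ] E} {b : F →L[ℝ] F} :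
    (∀ (t : ℝ) x y, B (exp (t • a) x) (exp (t • b) y) = B x y) ↔
      ∀ x y, B (a x) y + B x (b y) = 0 := by
  simpa [eq_comm, exp_zero] using exp_smul_apply_bilin_iff B (a := a) (b := b) (c := 0)

theorem apply_mem_of_exp_smul_apply_mem {W : Submodule ℝ E} (hW : IsClosed (W : Set E))
    {a : E →L[ℝ] E} {x : E} (h : ∀ t : ℝ, exp (t • a) x ∈ W) : a x ∈ W := by
  have hmem : deriv (fun s : ℝ => exp (s • a) x) 0 ∈
      closure (Submodule.span ℝ ((fun s : ℝ => exp (s • a) x) '' Set.univ) : Set E) :=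
    range_deriv_subset_closure_span_image _ dense_univ ⟨0, rfl⟩
  rw [(hasDerivAt_exp_smul_apply a x 0).deriv, exp_zero_smul_apply] at hmem
  refine closure_minimal (Submodule.span_le.2 ?_) hW hmem
  rintro _ ⟨t, -, rfl⟩
  exact h t

end Exp

/-! ### Congruence and its infinitesimal version -/

section Congruence

open NormedSpace QuadraticMap

variable {𝔸 : Type*} [NormedRing 𝔸] [NormedAlgebra ℝ 𝔸] [StarRing 𝔸]
  {E : Type*} [NormedAddCommGroup E] [NormedSpace ℝ E]

/-- The group of those units `g` for which the congruence `X ↦ g X g*` preserves the range of the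
map `H` and acts there by isometries of the quadratic form `Q`. -/
def congruenceGroup (H : E →L[ℝ] 𝔸) (Q : QuadraticForm ℝ E) : Subgroup 𝔸ˣ where
  carrier := {g | ∃ S : Q.IsometryEquiv Q, ∀ w, (g : 𝔸) * H w * star (g : 𝔸) = H (S w)}
  one_mem' := ⟨.refl Q, fun w => by rw [Units.val_one, star_one, one_mul, mul_one]; rfl⟩
  mul_mem' := by
    rintro g h ⟨S, hS⟩ ⟨T, hT⟩
    refine ⟨T.trans S, fun w => ?_⟩
    rw [Units.val_mul, star_mul]
    calc (g : 𝔸) * h * H w * (star (h : 𝔸) * star (g : 𝔸))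
        = g * (h * H w * star (h : 𝔸)) * star (g : 𝔸) := by noncomm_ring
      _ = H ((T.trans S) w) := by rw [hT, hS]; rfl
  inv_mem' := by
    rintro g ⟨S, hS⟩
    refine ⟨S.symm, fun w => ?_⟩
    have hg : star (g : 𝔸) * star ((g⁻¹ : 𝔸ˣ) : 𝔸) = 1 := by rw [← star_mul]; simp
    obtain ⟨v, rfl⟩ : ∃ v, S v = w := ⟨S.symm w, S.apply_symm_apply w⟩
    rw [← hS, show S.symm (S v) = v from S.symm_apply_apply v, mul_assoc, mul_assoc, hg, mul_one,
      Units.inv_mul_cancel_left]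

/-- The element `A`, acting infinitesimally by `X ↦ A X + X A*`, preserves the range of the map `H`
and acts there by the skew endomorphism `D` of the quadratic form `Q`. -/
structure ActsThrough (H : E →L[ℝ] 𝔸) (Q : QuadraticForm ℝ E) (A : 𝔸) (D : E →L[ℝ] E) : Prop where
  action : ∀ w, A * H w + H w * star A = H (D w)
  skew : ∀ v w, polar Q (D v) w + polar Q v (D w) = 0

namespace ActsThrough

variable {H : E →L[ℝ] 𝔸} {Q : QuadraticForm ℝ E} {A B : 𝔸} {D D' : E →L[ℝ] E}

theorem zero : ActsThrough H Q 0 0 :=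
  ⟨fun w => by simp, fun v w => by simp⟩

theorem add (hA : ActsThrough H Q A D) (hB : ActsThrough H Q B D') :
    ActsThrough H Q (A + B) (D + D') := by
  refine ⟨fun w => ?_, fun v w => ?_⟩
  · rw [add_apply, map_add, ← hA.action, ← hB.action, star_add]
    noncomm_ring
  · rw [add_apply, add_apply, polar_add_left,
      polar_add_right, add_add_add_comm, hA.skew, hB.skew, add_zero]

theorem smul [StarModule ℝ 𝔸] (r : ℝ) (hA : ActsThrough H Q A D) :
    ActsThrough H Q (r • A) (r • D) := by
  refine ⟨fun w => ?_, fun v w => ?_⟩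
  · rw [smul_apply, map_smul, ← hA.action, star_smul, star_trivial,
      smul_mul_assoc, mul_smul_comm, smul_add]
  · rw [smul_apply, smul_apply, polar_smul_left,
      polar_smul_right, ← smul_add, hA.skew, smul_zero]

theorem lie (hA : ActsThrough H Q A D) (hB : ActsThrough H Q B D') :
    ActsThrough H Q ⁅A, B⁆ ⁅D, D'⁆ := by
  have hD : ∀ w, ⁅D, D'⁆ w = D (D' w) - D' (D w) := fun _ => rfl
  refine ⟨fun w => ?_, fun v w => ?_⟩
  · rw [hD, map_sub, ← hA.action (D' w), ← hB.action (D w), ← hA.action, ← hB.action, Ring.lie_def,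
      star_sub, star_mul, star_mul]
    noncomm_ring
  · rw [hD, hD, polar_sub_left, polar_sub_right]
    linear_combination hA.skew (D' v) w - hB.skew (D v) w - hB.skew v (D w) + hA.skew v (D' w)

end ActsThrough

/-- The infinitesimal congruence action `X ↦ A X + X A*`. -/
def congruenceDeriv (A : 𝔸) : 𝔸 →L[ℝ] 𝔸 :=
  ContinuousLinearMap.mul ℝ 𝔸 A + (ContinuousLinearMap.mul ℝ 𝔸).flip (star A)

theorem congruenceDeriv_apply (A X : 𝔸) : congruenceDeriv A X = A * X + X * star A := rfl

variable [StarModule ℝ 𝔸] (H : E →L[ℝ] 𝔸) (Q : QuadraticForm ℝ E)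

/-- The Lie algebra of elements whose infinitesimal congruence action preserves the range of the
map `H`, acting there by skew endomorphisms of the quadratic form `Q`. -/
def congruenceLieAlgebra : LieSubalgebra ℝ 𝔸 where
  carrier := {A | ∃ D, ActsThrough H Q A D}
  zero_mem' := ⟨0, .zero⟩
  add_mem' := fun ⟨_, hA⟩ ⟨_, hB⟩ => ⟨_, hA.add hB⟩
  smul_mem' := fun r _ ⟨_, hA⟩ => ⟨_, hA.smul r⟩
  lie_mem' := fun ⟨_, hA⟩ ⟨_, hB⟩ => ⟨_, hA.lie hB⟩

variable [ContinuousStar 𝔸] [CompleteSpace 𝔸]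

theorem exp_smul_mul_mul_star (A X : 𝔸) (t : ℝ) :
    exp (t • A) * X * star (exp (t • A)) = exp (t • congruenceDeriv A) X := by
  have hf : ∀ s : ℝ, HasDerivAt (fun s : ℝ => exp (s • A) * X * exp (s • star A))
      (congruenceDeriv A (exp (s • A) * X * exp (s • star A))) s := fun s => by
    have h := ((hasDerivAt_exp_smul_const' (𝕂 := ℝ) A s).mul_const X).mul
      (hasDerivAt_exp_smul_const (𝕂 := ℝ) (star A) s)
    rwa [congruenceDeriv_apply, mul_assoc _ (exp (s • star A)) (star A), ← mul_assoc A,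
      ← mul_assoc A]
  rw [star_exp, star_smul, star_trivial, eq_exp_smul_apply_of_hasDerivAt hf t]
  simp only [zero_smul, exp_zero, one_mul, mul_one]

variable {H Q} [FiniteDimensional ℝ E]

theorem map_exp_smul_iff_skew {D : E →L[ℝ] E} :
    (∀ (t : ℝ) w, Q (exp (t • D) w) = Q w) ↔
      ∀ v w, polar Q (D v) w + polar Q v (D w) = 0 := by
  have : CompleteSpace E := FiniteDimensional.complete ℝ E
  refine Iff.trans ?_
    (bilin_exp_smul_eq_iff Q.polarBilin.toContinuousBilinearMap (a := D) (b := D))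
  simp only [LinearMap.toContinuousBilinearMap_apply, polarBilin_apply_apply]
  refine forall_congr' fun t => ⟨fun h v w => ?_, fun h w => ?_⟩
  · simp only [polar, ← map_add, h]
  · simpa [polar_self] using h w w

theorem ActsThrough.exp_smul_mul_mul_star {A : 𝔸} {D : E →L[ℝ] E} (hA : ActsThrough H Q A D)
    (t : ℝ) (w : E) : exp (t • A) * H w * star (exp (t • A)) = H (exp (t • D) w) := by
  have : CompleteSpace E := FiniteDimensional.complete ℝ E
  rw [_root_.exp_smul_mul_mul_star,
    map_exp_smul_apply_of_intertwine (b := congruenceDeriv A) fun w => (hA.action w).symm]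

theorem ActsThrough.mem_lieAlgebraOf {A : 𝔸} {D : E →L[ℝ] E} (hA : ActsThrough H Q A D) :
    A ∈ lieAlgebraOf (congruenceGroup H Q) := fun t => by
  have : CompleteSpace E := FiniteDimensional.complete ℝ E
  obtain ⟨g, hg⟩ := exists_unit_eq_exp (t • A)
  obtain ⟨s, hs⟩ := exists_unit_eq_exp (t • D)
  let S := (ContinuousLinearEquiv.unitsEquiv ℝ E s).toLinearEquiv
  have hS : ∀ w, S w = exp (t • D) w := fun w => DFunLike.congr_fun hs w
  refine ⟨g, ⟨⟨S, fun w => ?_⟩, fun w => ?_⟩, hg⟩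
  · exact (congrArg Q (hS w)).trans (map_exp_smul_iff_skew.2 hA.skew t w)
  · rw [hg, hA.exp_smul_mul_mul_star]
    exact congrArg H (hS w).symm

theorem exists_actsThrough_of_mem_lieAlgebraOf (hH : Function.Injective H) {A : 𝔸}
    (hA : A ∈ lieAlgebraOf (congruenceGroup H Q)) : ∃ D, ActsThrough H Q A D := by
  have : CompleteSpace E := FiniteDimensional.complete ℝ E
  have hcongr : ∀ t : ℝ, ∃ S : Q.IsometryEquiv Q, ∀ w,
      exp (t • congruenceDeriv A) (H w) = H (S w) := fun t => by
    obtain ⟨g, ⟨S, hS⟩, hg⟩ := hA t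
    exact ⟨S, fun w => by rw [← _root_.exp_smul_mul_mul_star, ← hg, hS]⟩
  have hrange : ∀ w, congruenceDeriv A (H w) ∈ LinearMap.range (H : E →ₗ[ℝ] 𝔸) := fun w =>
    apply_mem_of_exp_smul_apply_mem (Submodule.closed_of_finiteDimensional _) fun t =>
      let ⟨S, hS⟩ := hcongr t
      ⟨S w, (hS w).symm⟩
  let Hequiv := LinearEquiv.ofInjective (H : E →ₗ[ℝ] 𝔸) hH
  let D : E →L[ℝ] E := LinearMap.toContinuousLinearMap
    (Hequiv.symm.toLinearMap ∘ₗ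
      ((congruenceDeriv A).toLinearMap ∘ₗ H.toLinearMap).codRestrict _ hrange)
  have hD : ∀ w, H (D w) = congruenceDeriv A (H w) := fun w =>
    congrArg Subtype.val (Hequiv.apply_symm_apply ⟨_, hrange w⟩)
  refine ⟨D, fun w => (hD w).symm, map_exp_smul_iff_skew.1 fun t w => ?_⟩
  obtain ⟨S, hS⟩ := hcongr t
  have hexp : exp (t • D) w = S w := hH (by rw [map_exp_smul_apply_of_intertwine hD, hS])
  rw [hexp, S.map_app]

theorem lieAlgebraOf_congruenceGroup (hH : Function.Injective H) :
    lieAlgebraOf (congruenceGroup H Q) = congruenceLieAlgebra H Q :=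
  Set.Subset.antisymm (fun _ hA => exists_actsThrough_of_mem_lieAlgebraOf hH hA)
    fun _ ⟨_, hD⟩ => hD.mem_lieAlgebraOf

end Congruence

/-! ### Skew endomorphisms -/

section Skew

open NormedSpace

variable {E : Type*} [NormedAddCommGroup E] [InnerProductSpace ℝ E] [CompleteSpace E]
  {a : E →L[ℝ] E}

theorem mem_skewAdjoint_iff_inner :
    a ∈ skewAdjoint (E →L[ℝ] E) ↔ ∀ x y, inner ℝ (a x) y + inner ℝ x (a y) = 0 := by
  rw [skewAdjoint.mem_iff, eq_neg_iff_add_eq_zero, add_comm, ContinuousLinearMap.ext_iff]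
  refine forall_congr' fun x => ?_
  rw [ext_iff_inner_right ℝ]
  simp [inner_add_left, ContinuousLinearMap.star_eq_adjoint,
    ContinuousLinearMap.adjoint_inner_left]

theorem inner_apply_eq_neg_of_mem_skewAdjoint (ha : a ∈ skewAdjoint (E →L[ℝ] E)) (x y : E) :
    inner ℝ (a x) y = -inner ℝ x (a y) :=
  eq_neg_of_add_eq_zero_left (mem_skewAdjoint_iff_inner.1 ha x y)

theorem inner_apply_self_of_mem_skewAdjoint (ha : a ∈ skewAdjoint (E →L[ℝ] E)) (x : E) :
    inner ℝ x (a x) = (0 : ℝ) := by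
  linarith [mem_skewAdjoint_iff_inner.1 ha x x, real_inner_comm x (a x)]

theorem norm_exp_smul_apply_iff :
    (∀ (t : ℝ) x, ‖exp (t • a) x‖ = ‖x‖) ↔ a ∈ skewAdjoint (E →L[ℝ] E) := by
  rw [mem_skewAdjoint_iff_inner]
  refine Iff.trans (forall_congr' fun t => ?_) (bilin_exp_smul_eq_iff (innerSL ℝ))
  exact LinearMap.norm_map_iff_inner_map_map (exp (t • a))

theorem trace_eq_zero_of_mem_skewAdjoint [FiniteDimensional ℝ E]
    (ha : a ∈ skewAdjoint (E →L[ℝ] E)) : LinearMap.trace ℝ E (a : E →ₗ[ℝ] E) = 0 := by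
  rw [LinearMap.trace_eq_sum_inner _ (stdOrthonormalBasis ℝ E)]
  exact Finset.sum_eq_zero fun i _ => inner_apply_self_of_mem_skewAdjoint ha _

theorem det_exp_of_mem_skewAdjoint [FiniteDimensional ℝ E] (ha : a ∈ skewAdjoint (E →L[ℝ] E)) :
    LinearMap.det (exp a : E →L[ℝ] E).toLinearMap = 1 := by
  let _ : NormedAlgebra ℚ (E →L[ℝ] E) := .restrictScalars ℚ ℝ _
  let g : E →ₗᵢ[ℝ] E := ⟨(exp ((2⁻¹ : ℝ) • a) : E →L[ℝ] E), norm_exp_smul_apply_iff.2 ha _⟩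
  have habs : |LinearMap.det g.toLinearMap| = 1 :=
    (LinearMap.normDet_eq_abs_det _).symm.trans g.normDet_eq_one
  have hsq : exp a = exp ((2⁻¹ : ℝ) • a) ^ 2 := by
    rw [← exp_nsmul, ← Nat.cast_smul_eq_nsmul ℝ, smul_smul]
    norm_num
  rw [hsq, sq]
  calc LinearMap.det (g.toLinearMap ∘ₗ g.toLinearMap)
      = |LinearMap.det g.toLinearMap| ^ 2 := by rw [LinearMap.det_comp, sq_abs, sq]
    _ = 1 := by rw [habs, one_pow]

end Skew

/-! ### Octonion identities -/

namespace Octonion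

attribute [simp] fst_add snd_add fst_smul snd_smul fst_mul snd_mul

@[simp] theorem fst_mk (a b : ℍ[ℝ]) : (mk a b).fst = a := rfl
@[simp] theorem snd_mk (a b : ℍ[ℝ]) : (mk a b).snd = b := rfl
@[simp] theorem fst_one : (1 : Octonion).fst = 1 := rfl
@[simp] theorem snd_one : (1 : Octonion).snd = 0 := rfl
@[simp] theorem fst_sub (x y : Octonion) : (x - y).fst = x.fst - y.fst := rfl
@[simp] theorem snd_sub (x y : Octonion) : (x - y).snd = x.snd - y.snd := rfl
@[simp] theorem L_apply (x y : Octonion) : L x y = x * y := rfl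
@[simp] theorem R_apply (x y : Octonion) : R x y = y * x := rfl
@[simp] theorem mul_zero' (x : Octonion) : x * 0 = 0 := (L x).map_zero
@[simp] theorem zero_mul' (x : Octonion) : 0 * x = 0 := (R x).map_zero
theorem mul_one' (x : Octonion) : x * 1 = x := by apply ext_components <;> simp

theorem inner_eq (x y : Octonion) :
    inner ℝ x y = inner ℝ x.fst y.fst + inner ℝ x.snd y.snd := rfl

theorem inner_one_one : inner ℝ (1 : Octonion) (1 : Octonion) = (1 : ℝ) := by
  rw [inner_eq, Quaternion.inner_def]
  simp

instance : NeZero (1 : Octonion) :=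
  ⟨fun h => by simpa [h] using inner_one_one⟩

theorem C_apply (x : Octonion) : C x = mk (star x.fst) (-x.snd) := by
  have h : C x = (2 * inner ℝ 1 x : ℝ) • (1 : Octonion) - x := by
    simp [C, smul_smul]
  rw [h]
  apply ext_components
  · ext <;> simp [inner_eq, Quaternion.inner_def]; ring
  · ext <;> simp [inner_eq, Quaternion.inner_def]

@[simp] theorem fst_C (x : Octonion) : (C x).fst = star x.fst := by rw [C_apply]; rfl
@[simp] theorem snd_C (x : Octonion) : (C x).snd = -x.snd := by rw [C_apply]; rfl

@[simp] theorem C_C (x : Octonion) : C (C x) = x := by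
  apply ext_components <;> simp

theorem C_mul (x y : Octonion) : C (x * y) = C y * C x := by
  apply ext_components <;> simp

theorem inner_C_left (x y : Octonion) : inner ℝ (C x) y = inner ℝ x (C y) := by
  simp [inner_eq, Quaternion.inner_def]

theorem inner_mul_left (x y z : Octonion) : inner ℝ (x * y) z = inner ℝ y (C x * z) := by
  simp [inner_eq, Quaternion.inner_def]; ring

theorem inner_mul_right (x y z : Octonion) : inner ℝ (x * y) z = inner ℝ x (z * C y) := by
  simp [inner_eq, Quaternion.inner_def]; ring

theorem C_mul_mul_self (x z : Octonion) : C x * (x * z) = (inner ℝ x x : ℝ) • z := by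
  rw [inner_eq, Quaternion.inner_self, Quaternion.inner_self, add_smul]
  apply ext_components
  · calc (C x * (x * z)).fst
        = star x.fst * x.fst * z.fst + z.fst * (star x.snd * x.snd) := by
          simp only [fst_mul, snd_mul, fst_C, snd_C, star_add, star_mul, star_star]
          noncomm_ring
      _ = _ := by
          rw [Quaternion.star_mul_self, Quaternion.star_mul_self, Quaternion.coe_mul_eq_smul,
            Quaternion.mul_coe_eq_smul, fst_add, fst_smul, fst_smul]
  · calc (C x * (x * z)).snd
        = z.snd * (x.fst * star x.fst) + x.snd * star x.snd * z.snd := by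
          simp only [fst_mul, snd_mul, fst_C, snd_C, star_sub, star_mul, star_star]
          noncomm_ring
      _ = _ := by
          rw [Quaternion.self_mul_star, Quaternion.self_mul_star, Quaternion.mul_coe_eq_smul,
            Quaternion.coe_mul_eq_smul, snd_add, snd_smul, snd_smul]

theorem C_mul_mul_add (x y z : Octonion) :
    C x * (y * z) + C y * (x * z) = (2 * inner ℝ x y : ℝ) • z := by
  have hxy := C_mul_mul_self (x + y) z
  rw [real_inner_add_add_self, add_smul, add_smul, ← C_mul_mul_self, ← C_mul_mul_self, map_add,
    add_mul', add_mul', mul_add', mul_add'] at hxy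
  rw [← sub_eq_zero] at hxy ⊢
  rw [← hxy]
  abel

theorem mul_mul_C_self (x z : Octonion) : (z * x) * C x = (inner ℝ x x : ℝ) • z := by
  have h := congrArg C (C_mul_mul_self (C x) (C z))
  rwa [C_mul, C_mul, C_C, C_C, map_smul, C_C, inner_C_left, C_C] at h

theorem mul_mul_C_add (x y z : Octonion) :
    (z * x) * C y + (z * y) * C x = (2 * inner ℝ x y : ℝ) • z := by
  have h := congrArg C (C_mul_mul_add (C x) (C y) (C z))
  simp only [C_mul, C_C, map_smul, inner_C_left, map_add] at h
  rwa [add_comm]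

theorem exists_C_mul_eq_of_left_ne_zero {v : Octonion} (hv : v ≠ 0) (t : Octonion) :
    ∃ w, C (v * w) = t := by
  have h := C_mul_mul_self (C v) (C t)
  rw [C_C, inner_C_left, C_C] at h
  exact ⟨(inner ℝ v v : ℝ)⁻¹ • (C v * C t), by
    rw [mul_smul', h, inv_smul_smul₀ (inner_self_ne_zero.2 hv), C_C]⟩

theorem exists_C_mul_eq_of_right_ne_zero {u : Octonion} (hu : u ≠ 0) (t : Octonion) :
    ∃ w, C (w * u) = t := by
  have h := mul_mul_C_self (C u) (C t)
  rw [C_C, inner_C_left, C_C] at h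
  exact ⟨(inner ℝ u u : ℝ)⁻¹ • (C t * C u), by
    rw [smul_mul', h, inv_smul_smul₀ (inner_self_ne_zero.2 hu), C_C]⟩

instance : CompleteSpace Octonion := FiniteDimensional.complete ℝ Octonion

theorem star_C : star C = C := by
  refine ((ContinuousLinearMap.eq_adjoint_iff _ _).2 inner_C_left).symm

theorem star_C_comp_R (z : Octonion) : star (C.comp (R z)) = C.comp (L z) := by
  refine ((ContinuousLinearMap.eq_adjoint_iff _ _).2 fun x y => ?_).symm
  change inner ℝ (C (z * x)) y = inner ℝ x (C (y * z))
  rw [inner_C_left, inner_mul_left, C_mul]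

theorem star_C_comp_L (z : Octonion) : star (C.comp (L z)) = C.comp (R z) := by
  rw [← star_C_comp_R, star_star]

theorem C_comp_R_mul_C_comp_L_add (w z : Octonion) :
    C.comp (R w) * C.comp (L z) + C.comp (R z) * C.comp (L w) = (2 * inner ℝ w z : ℝ) • 1 := by
  ext x : 1
  change C (C (z * x) * w) + C (C (w * x) * z) = (2 * inner ℝ w z : ℝ) • x
  simp only [C_mul, C_C, C_mul_mul_add]

theorem C_comp_L_mul_C_comp_R_add (w z : Octonion) :
    C.comp (L w) * C.comp (R z) + C.comp (L z) * C.comp (R w) = (2 * inner ℝ w z : ℝ) • 1 := by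
  ext x : 1
  change C (w * C (x * z)) + C (z * C (x * w)) = (2 * inner ℝ w z : ℝ) • x
  simp only [C_mul, C_C, mul_mul_C_add, real_inner_comm]

/-- Octonion multiplication as a continuous bilinear map. -/
def mulL : Octonion →L[ℝ] Octonion →L[ℝ] Octonion :=
  LinearMap.toContinuousLinearMap
    { toFun := L
      map_add' := fun x y => ContinuousLinearMap.ext fun z => add_mul' x y z
      map_smul' := fun r x => ContinuousLinearMap.ext fun z => smul_mul' r x z }

end Octonion

open Octonion

/-! ### Infinitesimal triality -/

/-- The triples of skew endomorphisms of `𝕆` satisfying the derivative of the triality relation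
`g₂ (x y) = g₁ (x) g₃ (y)` at the identity. -/
structure IsInfinitesimalTriality (a₁ a₂ a₃ : Octonion →L[ℝ] Octonion) : Prop where
  skew_left : a₁ ∈ skewAdjoint (Octonion →L[ℝ] Octonion)
  skew_mul : a₂ ∈ skewAdjoint (Octonion →L[ℝ] Octonion)
  skew_right : a₃ ∈ skewAdjoint (Octonion →L[ℝ] Octonion)
  apply_mul : ∀ x y, a₂ (x * y) = a₁ x * y + x * a₃ y

theorem isSpecialOrthogonal_exp_smul_iff {a : Octonion →L[ℝ] Octonion} :
    (∀ t : ℝ, IsSpecialOrthogonal (NormedSpace.exp (t • a))) ↔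
      a ∈ skewAdjoint (Octonion →L[ℝ] Octonion) :=
  ⟨fun h => norm_exp_smul_apply_iff.1 fun t => (h t).1, fun h t =>
    ⟨norm_exp_smul_apply_iff.2 h t, det_exp_of_mem_skewAdjoint (skewAdjoint.smul_mem t h)⟩⟩

theorem mem_spin8_iff_exp {a : EndTriple} :
    a ∈ spin8 ↔ ∀ t : ℝ, IsTrialityTriple (NormedSpace.exp (t • a.1),
      NormedSpace.exp (t • a.2.1), NormedSpace.exp (t • a.2.2)) := by
  let _ : NormedAlgebra ℚ (Octonion →L[ℝ] Octonion) := .restrictScalars ℚ ℝ _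
  have hexp : ∀ t : ℝ, NormedSpace.exp (t • a) = (NormedSpace.exp (t • a.1),
      NormedSpace.exp (t • a.2.1), NormedSpace.exp (t • a.2.2)) := fun t =>
    Prod.ext (Prod.fst_exp _) (Prod.ext ((congrArg Prod.fst (Prod.snd_exp _)).trans
      (Prod.fst_exp _)) ((congrArg Prod.snd (Prod.snd_exp _)).trans (Prod.snd_exp _)))
  refine forall_congr' fun t => ?_
  rw [← hexp]
  constructor
  · rintro ⟨g, hg, heq⟩
    exact heq ▸ hg
  · intro h
    obtain ⟨g, hg⟩ := exists_unit_eq_exp (t • a)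
    exact ⟨g, show IsTrialityTriple g from hg ▸ h, hg⟩

theorem mem_spin8_iff {a : EndTriple} :
    a ∈ spin8 ↔ IsInfinitesimalTriality a.1 a.2.1 a.2.2 := by
  rw [mem_spin8_iff_exp]
  constructor
  · intro h
    exact ⟨isSpecialOrthogonal_exp_smul_iff.1 fun t => (h t).1,
      isSpecialOrthogonal_exp_smul_iff.1 fun t => (h t).2.1,
      isSpecialOrthogonal_exp_smul_iff.1 fun t => (h t).2.2.1,
      (exp_smul_apply_bilin_iff mulL).1 fun t => (h t).2.2.2⟩
  · intro h t
    exact ⟨isSpecialOrthogonal_exp_smul_iff.2 h.skew_left t,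
      isSpecialOrthogonal_exp_smul_iff.2 h.skew_mul t,
      isSpecialOrthogonal_exp_smul_iff.2 h.skew_right t,
      (exp_smul_apply_bilin_iff mulL).2 h.apply_mul t⟩

theorem C_mul_mul_C_mem_skewAdjoint {a : Octonion →L[ℝ] Octonion}
    (ha : a ∈ skewAdjoint (Octonion →L[ℝ] Octonion)) :
    C * a * C ∈ skewAdjoint (Octonion →L[ℝ] Octonion) := by
  simpa only [star_C] using skewAdjoint.conjugate ha C

theorem C_mul_C_mul_mul_C_mul_C (a : Octonion →L[ℝ] Octonion) : C * (C * a * C) * C = a := by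
  ext x : 1
  change C (C (a (C (C x)))) = a x
  rw [C_C, C_C]

/-- Triality says that the trilinear form `⟨x * y, C u⟩` is invariant, and this form is cyclic. -/
theorem IsInfinitesimalTriality.rotate {a₁ a₂ a₃ : Octonion →L[ℝ] Octonion}
    (h : IsInfinitesimalTriality a₁ a₂ a₃) :
    IsInfinitesimalTriality a₃ (C * a₁ * C) (C * a₂ * C) := by
  refine ⟨h.skew_right, C_mul_mul_C_mem_skewAdjoint h.skew_left,
    C_mul_mul_C_mem_skewAdjoint h.skew_mul, fun y z => ext_inner_right ℝ fun u => ?_⟩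
  have h₁ : inner ℝ (C (a₁ (C (y * z)))) u = -inner ℝ (C z) (a₁ (C u) * y) := by
    rw [inner_C_left, inner_apply_eq_neg_of_mem_skewAdjoint h.skew_left, C_mul, inner_mul_right,
      C_C]
  have h₂ : inner ℝ (y * C (a₂ (C z))) u = -inner ℝ (C z) (a₂ (C u * y)) := by
    rw [← C_C (y * _), inner_C_left, C_mul, inner_mul_right, C_C, C_C,
      inner_apply_eq_neg_of_mem_skewAdjoint h.skew_mul]
  have h₃ : inner ℝ (a₃ y * z) u = inner ℝ (C z) (C u * a₃ y) := by
    rw [← C_C (a₃ y * z), inner_C_left, C_mul, inner_mul_right, C_C]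
  change inner ℝ (C (a₁ (C (y * z)))) u = inner ℝ (a₃ y * z + y * C (a₂ (C z))) u
  rw [inner_add_left, h₁, h₂, h₃, h.apply_mul, inner_add_right]
  ring

/-! ### Block matrices -/

section ProdStar

section Transport

variable {V : Type*} [AddCommGroup V] [Module ℝ V] [TopologicalSpace V]
  [IsTopologicalAddGroup V] [ContinuousConstSMul ℝ V]
  {H : Type*} [NormedAddCommGroup H] [InnerProductSpace ℝ H] [CompleteSpace H]

/-- Transposition on the endomorphisms of a topological vector space identified with a Hilbert
space. -/
abbrev starRingOfEquiv (e : V ≃L[ℝ] H) : StarRing (V →L[ℝ] V) where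
  star M := e.conjContinuousAlgEquiv.symm (star (e.conjContinuousAlgEquiv M))
  star_involutive M := by
    simp only [ContinuousAlgEquiv.apply_symm_apply, star_star, ContinuousAlgEquiv.symm_apply_apply]
  star_mul M N := by simp
  star_add M N := by simp

theorem starModule_of_equiv (e : V ≃L[ℝ] H) :
    letI := starRingOfEquiv e; StarModule ℝ (V →L[ℝ] V) :=
  letI := starRingOfEquiv e
  ⟨fun r M => show e.conjContinuousAlgEquiv.symm _ = r • e.conjContinuousAlgEquiv.symm _ by simp⟩

theorem continuousStar_of_equiv (e : V ≃L[ℝ] H) :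
    letI := starRingOfEquiv e; ContinuousStar (V →L[ℝ] V) :=
  letI := starRingOfEquiv e
  ⟨e.conjContinuousAlgEquiv.symm.continuous.comp
    (continuous_star.comp e.conjContinuousAlgEquiv.continuous)⟩

theorem eq_starRingOfEquiv_star_iff (e : V ≃L[ℝ] H) (M N : V →L[ℝ] V) :
    N = (starRingOfEquiv e).star M ↔ ∀ v w, inner ℝ (e (N v)) (e w) = inner ℝ (e v) (e (M w)) := by
  change N = e.conjContinuousAlgEquiv.symm (star (e.conjContinuousAlgEquiv M)) ↔ _
  rw [ContinuousAlgEquiv.eq_symm_apply, ContinuousLinearMap.star_eq_adjoint,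
    ContinuousLinearMap.eq_adjoint_iff, e.surjective.forall]
  refine forall_congr' fun v => ?_
  rw [e.surjective.forall]
  simp

end Transport

variable {E F : Type*} [NormedAddCommGroup E] [InnerProductSpace ℝ E] [CompleteSpace E]
  [NormedAddCommGroup F] [InnerProductSpace ℝ F] [CompleteSpace F]

/-- Transposition of endomorphisms of `E × F` for the inner product of the Hilbert sum. -/
instance : StarRing (E × F →L[ℝ] E × F) :=
  starRingOfEquiv (WithLp.prodContinuousLinearEquiv 2 ℝ E F).symm

instance : StarModule ℝ (E × F →L[ℝ] E × F) :=
  starModule_of_equiv (WithLp.prodContinuousLinearEquiv 2 ℝ E F).symm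

instance : ContinuousStar (E × F →L[ℝ] E × F) :=
  continuousStar_of_equiv (WithLp.prodContinuousLinearEquiv 2 ℝ E F).symm

theorem eq_prod_star_iff (M N : E × F →L[ℝ] E × F) :
    N = star M ↔ ∀ v w : E × F, inner ℝ (N v).1 w.1 + inner ℝ (N v).2 w.2 =
      (inner ℝ v.1 (M w).1 + inner ℝ v.2 (M w).2 : ℝ) :=
  eq_starRingOfEquiv_star_iff (WithLp.prodContinuousLinearEquiv 2 ℝ E F).symm M N

end ProdStar

/-- The endomorphisms of `𝕆²`, in which the half-spin representation takes its values. -/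
abbrev End2 : Type := Octonion2 →L[ℝ] Octonion2

section Block

variable (A B D E A' B' D' E' : Octonion →L[ℝ] Octonion)

@[simp] theorem blockEnd_apply (v : Octonion2) :
    blockEnd A B D E v = (A v.1 + B v.2, D v.1 + E v.2) := rfl

theorem exists_eq_blockEnd (M : End2) : ∃ A B D E, M = blockEnd A B D E := by
  refine ⟨(ContinuousLinearMap.fst ℝ _ _).comp (M.comp (ContinuousLinearMap.inl ℝ _ _)),
    (ContinuousLinearMap.fst ℝ _ _).comp (M.comp (ContinuousLinearMap.inr ℝ _ _)),
    (ContinuousLinearMap.snd ℝ _ _).comp (M.comp (ContinuousLinearMap.inl ℝ _ _)),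
    (ContinuousLinearMap.snd ℝ _ _).comp (M.comp (ContinuousLinearMap.inr ℝ _ _)),
    ContinuousLinearMap.ext fun v => ?_⟩
  calc M v = M ((v.1, 0) + (0, v.2)) := by simp
    _ = _ := map_add M _ _

variable {A B D E A' B' D' E'} in
theorem blockEnd_inj :
    blockEnd A B D E = blockEnd A' B' D' E' ↔ A = A' ∧ B = B' ∧ D = D' ∧ E = E' := by
  refine ⟨fun h => ?_, by rintro ⟨rfl, rfl, rfl, rfl⟩; rfl⟩
  have h₁ := fun x => DFunLike.congr_fun h (x, 0)
  have h₂ := fun x => DFunLike.congr_fun h (0, x)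
  simp only [blockEnd_apply, map_zero, add_zero, zero_add, Prod.mk.injEq] at h₁ h₂
  exact ⟨ContinuousLinearMap.ext fun x => (h₁ x).1, ContinuousLinearMap.ext fun x => (h₂ x).1,
    ContinuousLinearMap.ext fun x => (h₁ x).2, ContinuousLinearMap.ext fun x => (h₂ x).2⟩

theorem blockEnd_mul :
    blockEnd A B D E * blockEnd A' B' D' E' =
      blockEnd (A * A' + B * D') (A * B' + B * E') (D * A' + E * D') (D * B' + E * E') :=
  ContinuousLinearMap.ext fun v => by
    simp only [mul_apply_eq_comp, blockEnd_apply, add_apply, map_add, add_add_add_comm]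

theorem blockEnd_add :
    blockEnd A B D E + blockEnd A' B' D' E' = blockEnd (A + A') (B + B') (D + D') (E + E') :=
  ContinuousLinearMap.ext fun v => by
    simp only [add_apply, blockEnd_apply, Prod.mk_add_mk, add_add_add_comm]

theorem blockEnd_smul (r : ℝ) :
    r • blockEnd A B D E = blockEnd (r • A) (r • B) (r • D) (r • E) :=
  ContinuousLinearMap.ext fun v => by
    simp only [smul_apply, blockEnd_apply, Prod.smul_mk, smul_add]

theorem blockEnd_zero : blockEnd 0 0 0 0 = 0 :=
  ContinuousLinearMap.ext fun v => by simp

theorem blockEnd_smul_one (r : ℝ) : blockEnd (r • 1) 0 0 (r • 1) = r • 1 :=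
  ContinuousLinearMap.ext fun v => by simp; rfl

theorem star_blockEnd :
    star (blockEnd A B D E) = blockEnd (star A) (star D) (star B) (star E) := by
  refine ((eq_prod_star_iff _ _).2 fun v w => ?_).symm
  simp only [blockEnd_apply, inner_add_left, inner_add_right,
    ContinuousLinearMap.star_eq_adjoint, ContinuousLinearMap.adjoint_inner_left]
  ring

theorem trace_blockEnd :
    LinearMap.trace ℝ Octonion2 (blockEnd A B D E : Octonion2 →ₗ[ℝ] Octonion2)
      = LinearMap.trace ℝ Octonion (A : Octonion →ₗ[ℝ] Octonion)
        + LinearMap.trace ℝ Octonion (E : Octonion →ₗ[ℝ] Octonion) := by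
  have hsplit : (blockEnd A B D E : Octonion2 →ₗ[ℝ] Octonion2)
      = LinearMap.prodMap (A : Octonion →ₗ[ℝ] Octonion) (E : Octonion →ₗ[ℝ] Octonion)
        + LinearMap.inl ℝ _ _ ∘ₗ ((B : Octonion →ₗ[ℝ] Octonion) ∘ₗ LinearMap.snd ℝ _ _)
        + LinearMap.inr ℝ _ _ ∘ₗ ((D : Octonion →ₗ[ℝ] Octonion) ∘ₗ LinearMap.fst ℝ _ _) := by
    refine LinearMap.ext fun v => ?_
    simp [add_comm]
  rw [hsplit, map_add, map_add, LinearMap.trace_prodMap',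
    ← LinearMap.trace_comp_comm' (LinearMap.inl ℝ Octonion Octonion),
    ← LinearMap.trace_comp_comm' (LinearMap.inr ℝ Octonion Octonion), LinearMap.comp_assoc,
    LinearMap.comp_assoc, LinearMap.snd_comp_inl, LinearMap.fst_comp_inr]
  simp

end Block

theorem trace_eq_zero_of_mem_spin91 {M : End2} (hM : M ∈ spin91) :
    LinearMap.trace ℝ Octonion2 (M : Octonion2 →ₗ[ℝ] Octonion2) = 0 := by
  obtain ⟨r, w, x, a, ha, rfl⟩ := hM
  have ha := mem_spin8_iff.1 ha
  rw [trace_blockEnd, ContinuousLinearMap.toLinearMap_add, ContinuousLinearMap.toLinearMap_sub,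
    map_add, map_sub, trace_eq_zero_of_mem_skewAdjoint ha.skew_left,
    trace_eq_zero_of_mem_skewAdjoint ha.skew_right]
  ring

/-! ### Hermitian octonionic matrices -/

/-- The coordinates `(α, β, z)` of a Hermitian octonionic `2 × 2` matrix, `α` and `β` being the
diagonal entries. -/
abbrev Herm2 : Type := ℝ × ℝ × Octonion

/-- The quadratic form `|z|² - α β`, minus the determinant, on Hermitian octonionic matrices. -/
def hermForm : QuadraticForm ℝ Herm2 :=
  let z : Herm2 →ₗ[ℝ] Octonion := LinearMap.snd ℝ ℝ Octonion ∘ₗ LinearMap.snd ℝ ℝ _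
  LinearMap.BilinMap.toQuadraticMap ((innerₗ Octonion).compl₁₂ z z)
    - QuadraticMap.linMulLin (LinearMap.fst ℝ ℝ _)
        (LinearMap.fst ℝ ℝ Octonion ∘ₗ LinearMap.snd ℝ ℝ _)

theorem hermForm_apply (w : Herm2) : hermForm w = inner ℝ w.2.2 w.2.2 - w.1 * w.2.1 := rfl

theorem polar_hermForm (v w : Herm2) :
    QuadraticMap.polar hermForm v w = 2 * inner ℝ v.2.2 w.2.2 - v.1 * w.2.1 - v.2.1 * w.1 := by
  simp only [QuadraticMap.polar, hermForm_apply, Prod.fst_add, Prod.snd_add, inner_add_left,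
    inner_add_right, real_inner_comm]
  ring

/-- The symmetric operator on `𝕆²` defined by a Hermitian octonionic matrix. -/
def hermOp : Herm2 →L[ℝ] End2 :=
  LinearMap.toContinuousLinearMap
    { toFun := fun w => blockEnd (w.1 • 1) (C.comp (R w.2.2)) (C.comp (L w.2.2)) (w.2.1 • 1)
      map_add' := fun v w => by
        rw [blockEnd_add]
        congr 1 <;> ext x : 1 <;> simp [mul_add', add_mul', add_smul]
      map_smul' := fun r w => by
        rw [RingHom.id_apply, blockEnd_smul]
        congr 1 <;> ext x : 1 <;> simp [mul_smul', smul_mul', mul_smul] }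

theorem hermOp_apply (w : Herm2) :
    hermOp w = blockEnd (w.1 • 1) (C.comp (R w.2.2)) (C.comp (L w.2.2)) (w.2.1 • 1) := rfl

theorem hermOp_injective : Function.Injective hermOp := by
  rintro ⟨α, β, z⟩ ⟨α', β', z'⟩ h
  obtain ⟨hα, -, hz, hβ⟩ := blockEnd_inj.1 h
  have hα := smul_left_injective ℝ one_ne_zero (DFunLike.congr_fun hα 1)
  have hβ := smul_left_injective ℝ one_ne_zero (DFunLike.congr_fun hβ 1)
  have hz : z = z' := by simpa [mul_one'] using congrArg C (DFunLike.congr_fun hz 1)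
  exact Prod.ext hα (Prod.ext hβ hz)

theorem star_hermOp (w : Herm2) : star (hermOp w) = hermOp w := by
  simp only [hermOp_apply, star_blockEnd, star_C_comp_R, star_C_comp_L, star_smul, star_one,
    star_trivial]

/-! ### `spin(9,1)` and the Hermitian matrices -/

section Spin91

theorem blockEnd_scaling_mem_congruenceLieAlgebra (r : ℝ) :
    blockEnd (r • 1) 0 0 (-(r • 1)) ∈ congruenceLieAlgebra hermOp hermForm := by
  refine ⟨LinearMap.toContinuousLinearMap
    { toFun := fun w => (2 * r * w.1, -(2 * r * w.2.1), 0)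
      map_add' := fun v w => by ext <;> simp <;> ring
      map_smul' := fun s v => by ext <;> simp <;> ring }, fun w => ?_, fun v w => ?_⟩
  · simp only [hermOp_apply, star_blockEnd, blockEnd_mul, blockEnd_add]
    congr 1 <;> ext x : 1 <;> simp [smul_smul] <;> module
  · simp [polar_hermForm]
    ring

theorem blockEnd_upper_mem_congruenceLieAlgebra (u : Octonion) :
    blockEnd 0 (C.comp (R u)) 0 0 ∈ congruenceLieAlgebra hermOp hermForm := by
  refine ⟨LinearMap.toContinuousLinearMap
    { toFun := fun w => (2 * inner ℝ u w.2.2, 0, w.2.1 • u)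
      map_add' := fun v w => by simp [inner_add_right, mul_add, add_smul]
      map_smul' := fun s v => by simp [inner_smul_right, mul_smul]; ring },
    fun w => ?_, fun v w => ?_⟩
  · simp only [hermOp_apply, star_blockEnd, blockEnd_mul, blockEnd_add, star_C_comp_R, star_zero,
      zero_mul, mul_zero, zero_add, add_zero, C_comp_R_mul_C_comp_L_add]
    congr 1 <;> ext x : 1 <;> simp [mul_smul', smul_mul']
  · simp [polar_hermForm, inner_smul_left, inner_smul_right, real_inner_comm]
    ring

theorem blockEnd_lower_mem_congruenceLieAlgebra (u : Octonion) :
    blockEnd 0 0 (C.comp (L u)) 0 ∈ congruenceLieAlgebra hermOp hermForm := by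
  refine ⟨LinearMap.toContinuousLinearMap
    { toFun := fun w => (0, 2 * inner ℝ u w.2.2, w.1 • u)
      map_add' := fun v w => by simp [inner_add_right, mul_add, add_smul]
      map_smul' := fun s v => by simp [inner_smul_right, mul_smul]; ring },
    fun w => ?_, fun v w => ?_⟩
  · simp only [hermOp_apply, star_blockEnd, blockEnd_mul, blockEnd_add, star_C_comp_L, star_zero,
      zero_mul, mul_zero, zero_add, add_zero, C_comp_L_mul_C_comp_R_add]
    congr 1 <;> ext x : 1 <;> simp [mul_smul', smul_mul']
  · simp [polar_hermForm, inner_smul_left, inner_smul_right, real_inner_comm]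
    ring

section Diagonal

variable {a₁ a₃ : Octonion →L[ℝ] Octonion}

theorem blockEnd_diag_mul_hermOp_add (h₁ : a₁ ∈ skewAdjoint (Octonion →L[ℝ] Octonion))
    (h₃ : a₃ ∈ skewAdjoint (Octonion →L[ℝ] Octonion)) (w : Herm2) :
    blockEnd a₁ 0 0 a₃ * hermOp w + hermOp w * star (blockEnd a₁ 0 0 a₃) =
      blockEnd 0 (a₁ * C.comp (R w.2.2) - C.comp (R w.2.2) * a₃)
        (star (a₁ * C.comp (R w.2.2) - C.comp (R w.2.2) * a₃)) 0 := by
  rw [skewAdjoint.mem_iff] at h₁ h₃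
  simp only [hermOp_apply, star_blockEnd, blockEnd_mul, blockEnd_add, star_sub, star_mul, h₁, h₃,
    star_C_comp_R, star_zero, zero_mul, mul_zero, zero_add, add_zero, mul_neg, neg_mul,
    smul_mul_assoc, mul_smul_comm, mul_one, one_mul, add_neg_cancel, smul_zero]
  congr 1
  abel

theorem mul_C_comp_R_sub_eq_iff {u z : Octonion} :
    a₁ * C.comp (R z) - C.comp (R z) * a₃ = C.comp (R u) ↔
      ∀ y, (C * a₁ * C) (y * z) = a₃ y * z + y * u := by
  rw [sub_eq_iff_eq_add', ContinuousLinearMap.ext_iff]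
  refine forall_congr' fun y => ?_
  change a₁ (C (y * z)) = C (a₃ y * z) + C (y * u) ↔ C (a₁ (C (y * z))) = a₃ y * z + y * u
  rw [← map_add]
  exact ⟨fun h => by rw [h, C_C], fun h => by rw [← h, C_C]⟩

theorem exists_isInfinitesimalTriality_of_diag_mem
    (h₁ : a₁ ∈ skewAdjoint (Octonion →L[ℝ] Octonion))
    (h₃ : a₃ ∈ skewAdjoint (Octonion →L[ℝ] Octonion))
    (h : blockEnd a₁ 0 0 a₃ ∈ congruenceLieAlgebra hermOp hermForm) :
    ∃ a₂, IsInfinitesimalTriality a₁ a₂ a₃ := by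
  obtain ⟨D, hD⟩ := h
  let inclusion : Octonion →L[ℝ] Herm2 := .comp (.inr ℝ ℝ _) (.inr ℝ ℝ _)
  let τ : Octonion →L[ℝ] Octonion := .comp (.comp (.snd ℝ ℝ _) (.snd ℝ ℝ _)) (D.comp inclusion)
  have hτ : τ ∈ skewAdjoint (Octonion →L[ℝ] Octonion) := mem_skewAdjoint_iff_inner.2 fun y z => by
    have h := hD.skew (0, 0, y) (0, 0, z)
    simp only [polar_hermForm, mul_zero, zero_mul, sub_zero, ← mul_add] at h
    exact (mul_eq_zero.1 h).resolve_left two_ne_zero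
  have hrotated : IsInfinitesimalTriality a₃ (C * a₁ * C) τ := by
    refine ⟨h₃, C_mul_mul_C_mem_skewAdjoint h₁, hτ, fun y z => ?_⟩
    have h := hD.action (0, 0, z)
    rw [blockEnd_diag_mul_hermOp_add h₁ h₃, hermOp_apply, blockEnd_inj] at h
    exact mul_C_comp_R_sub_eq_iff.1 h.2.1 y
  refine ⟨C * τ * C, ?_⟩
  simpa only [C_mul_C_mul_mul_C_mul_C] using hrotated.rotate.rotate

theorem IsInfinitesimalTriality.diag_mem_congruenceLieAlgebra {a₂ : Octonion →L[ℝ] Octonion}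
    (h : IsInfinitesimalTriality a₁ a₂ a₃) :
    blockEnd a₁ 0 0 a₃ ∈ congruenceLieAlgebra hermOp hermForm := by
  let proj : Herm2 →L[ℝ] Octonion := .comp (.snd ℝ ℝ _) (.snd ℝ ℝ _)
  refine ⟨.prod 0 (.prod 0 ((C * a₂ * C).comp proj)), fun w => ?_, fun v w => ?_⟩
  · rw [blockEnd_diag_mul_hermOp_add h.skew_left h.skew_right,
      mul_C_comp_R_sub_eq_iff.2 fun y => h.rotate.apply_mul y w.2.2, star_C_comp_R, hermOp_apply]
    simp [proj]
  · have hskew := mem_skewAdjoint_iff_inner.1 h.rotate.skew_right v.2.2 w.2.2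
    simp only [polar_hermForm, ContinuousLinearMap.prod_apply, zero_apply, zero_mul, mul_zero,
      sub_zero, ← mul_add]
    exact mul_eq_zero_of_right _ hskew

end Diagonal

theorem sub_smul_one_mem_skewAdjoint {𝔸 : Type*} [Ring 𝔸] [StarRing 𝔸] [Algebra ℝ 𝔸]
    [StarModule ℝ 𝔸] {a : 𝔸} {r : ℝ} (h : a + star a = (2 * r) • 1) :
    a - r • 1 ∈ skewAdjoint 𝔸 := by
  rw [skewAdjoint.mem_iff, star_sub, star_smul, star_one, star_trivial r, eq_sub_of_add_eq' h]
  module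

theorem hermOp_fst_one : hermOp (1, 0, 0) = blockEnd 1 0 0 0 := by
  rw [hermOp_apply]
  congr 1 <;> ext x : 1 <;> simp

theorem hermOp_snd_one : hermOp (0, 1, 0) = blockEnd 0 0 0 1 := by
  rw [hermOp_apply]
  congr 1 <;> ext x : 1 <;> simp

theorem blockEnd_spin91_eq (a₁ a₃ : Octonion →L[ℝ] Octonion) (r : ℝ) (w x : Octonion) :
    blockEnd (a₁ + r • ContinuousLinearMap.id ℝ Octonion) (C.comp (R w)) (C.comp (L x))
        (a₃ - r • ContinuousLinearMap.id ℝ Octonion) =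
      blockEnd a₁ 0 0 a₃ + (blockEnd (r • 1) 0 0 (-(r • 1)) + blockEnd 0 (C.comp (R w)) 0 0 +
        blockEnd 0 0 (C.comp (L x)) 0) := by
  simp only [blockEnd_add, add_zero, zero_add]
  rw [← sub_eq_add_neg]
  rfl

/-- The images of the two diagonal idempotents under the action determine the off-diagonal blocks
and the symmetric parts of the diagonal blocks. -/
theorem exists_off_diag_of_mem_congruenceLieAlgebra {M : End2}
    (hM : M ∈ congruenceLieAlgebra hermOp hermForm) :
    ∃ (r : ℝ) (w x : Octonion) (a₁ a₃ : Octonion →L[ℝ] Octonion),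
      a₁ ∈ skewAdjoint (Octonion →L[ℝ] Octonion) ∧ a₃ ∈ skewAdjoint (Octonion →L[ℝ] Octonion) ∧
      M = blockEnd (a₁ + r • ContinuousLinearMap.id ℝ Octonion) (C.comp (R w)) (C.comp (L x))
        (a₃ - r • ContinuousLinearMap.id ℝ Octonion) := by
  obtain ⟨D, hD⟩ := hM
  obtain ⟨a, b, c, d, rfl⟩ := exists_eq_blockEnd M
  have hfst := hD.action (1, 0, 0)
  have hsnd := hD.action (0, 1, 0)
  have htrace := hD.skew (1, 0, 0) (0, 1, 0)
  rw [hermOp_fst_one, hermOp_apply, star_blockEnd, blockEnd_mul, blockEnd_mul, blockEnd_add,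
    blockEnd_inj] at hfst
  rw [hermOp_snd_one, hermOp_apply, star_blockEnd, blockEnd_mul, blockEnd_mul, blockEnd_add,
    blockEnd_inj] at hsnd
  simp only [polar_hermForm, inner_zero_left, inner_zero_right, mul_zero, mul_one, zero_mul,
    one_mul, add_zero, zero_add, sub_zero, zero_sub] at hfst hsnd htrace
  set r : ℝ := (D (1, 0, 0)).1 / 2 with hr
  have ha : a - r • 1 ∈ skewAdjoint (Octonion →L[ℝ] Octonion) :=
    sub_smul_one_mem_skewAdjoint (by rw [hfst.1, hr, mul_div_cancel₀ _ two_ne_zero])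
  have hd : d - (-r) • 1 ∈ skewAdjoint (Octonion →L[ℝ] Octonion) :=
    sub_smul_one_mem_skewAdjoint (by rw [hsnd.2.2.2, hr]; congr 1; linarith)
  refine ⟨r, (D (0, 1, 0)).2.2, (D (1, 0, 0)).2.2, _, _, ha, hd, ?_⟩
  rw [blockEnd_inj, neg_smul, sub_neg_eq_add]
  exact ⟨(sub_add_cancel _ _).symm, hsnd.2.1, hfst.2.2.1, (add_sub_cancel_right _ _).symm⟩

theorem spin91_eq_congruenceLieAlgebra :
    spin91 = SetLike.coe (congruenceLieAlgebra hermOp hermForm) := by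
  have hrest : ∀ (r : ℝ) (w x : Octonion), blockEnd (r • 1) 0 0 (-(r • 1)) +
      blockEnd 0 (C.comp (R w)) 0 0 + blockEnd 0 0 (C.comp (L x)) 0 ∈
        congruenceLieAlgebra hermOp hermForm := fun r w x =>
    add_mem (add_mem (blockEnd_scaling_mem_congruenceLieAlgebra r)
      (blockEnd_upper_mem_congruenceLieAlgebra w)) (blockEnd_lower_mem_congruenceLieAlgebra x)
  ext M
  constructor
  · rintro ⟨r, w, x, a, ha, rfl⟩
    rw [blockEnd_spin91_eq]
    exact add_mem (mem_spin8_iff.1 ha).diag_mem_congruenceLieAlgebra (hrest r w x)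
  · intro hM
    obtain ⟨r, w, x, a₁, a₃, h₁, h₃, rfl⟩ := exists_off_diag_of_mem_congruenceLieAlgebra hM
    rw [blockEnd_spin91_eq] at hM
    obtain ⟨a₂, h⟩ := exists_isInfinitesimalTriality_of_diag_mem h₁ h₃
      ((add_mem_cancel_right (hrest r w x)).1 hM)
    exact ⟨r, w, x, (a₁, a₂, a₃), mem_spin8_iff.2 h, rfl⟩

end Spin91

/-! ### The centralizer of the vectors in the even Clifford algebra -/

section NumberOperator

open ExteriorAlgebra

variable {K V κ : Type*} [Field K] [AddCommGroup V] [Module K V] [Fintype κ]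

/-- The number operator of the exterior algebra, acting on `⋀ᵏ V` as multiplication by `k`. -/
def numberOperator (b : Module.Basis κ K V) : ExteriorAlgebra K V →ₗ[K] ExteriorAlgebra K V :=
  ∑ i, LinearMap.mulLeft K (ι K (b i)) ∘ₗ CliffordAlgebra.contractLeft (b.coord i)

variable (b : Module.Basis κ K V)

theorem numberOperator_apply (x : ExteriorAlgebra K V) :
    numberOperator b x = ∑ i, ι K (b i) * CliffordAlgebra.contractLeft (b.coord i) x := by
  simp [numberOperator]

theorem numberOperator_ι_mul (v : V) (x : ExteriorAlgebra K V) :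
    numberOperator b (ι K v * x) = ι K v * x + ι K v * numberOperator b x := by
  have hterm : ∀ i, ι K (b i) * CliffordAlgebra.contractLeft (b.coord i) (ι K v * x)
      = ι K (b.coord i v • b i) * x
        + ι K v * (ι K (b i) * CliffordAlgebra.contractLeft (b.coord i) x) := fun i => by
    have hcontract : CliffordAlgebra.contractLeft (b.coord i) (ι K v * x) = b.coord i v • x
        - ι K v * CliffordAlgebra.contractLeft (b.coord i) x :=
      CliffordAlgebra.contractLeft_ι_mul _ _ _
    have hswap : ι K (b i) * ι K v = -(ι K v * ι K (b i)) :=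
      eq_neg_of_add_eq_zero_left (ι_add_mul_swap _ _)
    rw [hcontract, mul_sub, ← mul_assoc, hswap, neg_mul, sub_neg_eq_add, mul_assoc, map_smul,
      mul_smul_comm, smul_mul_assoc]
  simp only [numberOperator_apply, hterm, Finset.mul_sum, Finset.sum_add_distrib, ← Finset.sum_mul,
    ← map_sum, Module.Basis.coord_apply, b.sum_repr]

theorem numberOperator_of_mem_exteriorPower {k : ℕ} {x : ExteriorAlgebra K V} (hx : x ∈ ⋀[K]^k V) :
    numberOperator b x = (k : K) • x := by
  induction k generalizing x with
  | zero =>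
    obtain ⟨r, rfl⟩ := Submodule.mem_one.1 ((pow_zero (LinearMap.range (ι K (M := V)))).le hx)
    rw [numberOperator_apply, Nat.cast_zero, zero_smul]
    exact Finset.sum_eq_zero fun i _ =>
      (congrArg _ (CliffordAlgebra.contractLeft_algebraMap _ _ _)).trans (mul_zero _)
  | succ k ih =>
    replace hx : x ∈ LinearMap.range (ι K (M := V)) * LinearMap.range (ι K (M := V)) ^ k :=
      (pow_succ' (LinearMap.range (ι K (M := V))) k).le hx
    induction hx using Submodule.mul_induction_on' with
    | mem_mul_mem m hm n hn =>
      obtain ⟨v, rfl⟩ := hm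
      rw [numberOperator_ι_mul, ih hn, mul_smul_comm, Nat.cast_succ, add_smul, one_smul, add_comm]
    | add x _ y _ hx hy => rw [map_add, hx, hy, smul_add]

theorem proj_numberOperator (k : ℕ) (x : ExteriorAlgebra K V) :
    GradedAlgebra.proj (fun i : ℕ => ⋀[K]^i V) k (numberOperator b x)
      = (k : K) • GradedAlgebra.proj (fun i : ℕ => ⋀[K]^i V) k x := by
  induction x using DirectSum.Decomposition.inductionOn (fun i : ℕ => ⋀[K]^i V) with
  | zero => simp
  | @homogeneous i m =>
    rw [numberOperator_of_mem_exteriorPower b m.2, map_smul]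
    by_cases h : i = k
    · subst h
      rfl
    · have hproj : GradedAlgebra.proj (fun i : ℕ => ⋀[K]^i V) k (m : ExteriorAlgebra K V) = 0 :=
        DirectSum.decompose_of_mem_ne (fun i : ℕ => ⋀[K]^i V) m.2 h
      rw [hproj, smul_zero, smul_zero]
  | add x y hx hy => rw [map_add, map_add, map_add, hx, hy, smul_add]

theorem exists_eq_algebraMap_of_contractLeft_eq_zero {κ : Type*} [Finite κ] [CharZero K]
    (b : Module.Basis κ K V) {x : ExteriorAlgebra K V}
    (h : ∀ d : Module.Dual K V, CliffordAlgebra.contractLeft d x = 0) :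
    ∃ r : K, x = algebraMap K _ r := by
  classical
  have := Fintype.ofFinite κ
  have hN : numberOperator b x = 0 := by
    rw [numberOperator_apply]
    exact Finset.sum_eq_zero fun i _ => by rw [h, mul_zero]
  have hk : ∀ k : ℕ, k ≠ 0 → GradedAlgebra.proj (fun i : ℕ => ⋀[K]^i V) k x = 0 := fun k hk => by
    have hproj := proj_numberOperator b k x
    rw [hN, map_zero] at hproj
    exact (smul_eq_zero.1 hproj.symm).resolve_left (Nat.cast_ne_zero.2 hk)
  have hx : x = GradedAlgebra.proj (fun i : ℕ => ⋀[K]^i V) 0 x := by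
    conv_lhs => rw [← DirectSum.sum_support_decompose (fun i : ℕ => ⋀[K]^i V) x]
    refine Finset.sum_eq_single 0 (fun k _ h => hk k h) fun hn => ?_
    rw [DFinsupp.notMem_support_iff] at hn
    rw [hn]
    rfl
  have hmem : x ∈ ⋀[K]^0 V := hx ▸ SetLike.coe_mem _
  obtain ⟨r, hr⟩ := Submodule.mem_one.1 ((pow_zero (LinearMap.range (ι K (M := V)))).le hmem)
  exact ⟨r, hr.symm⟩

end NumberOperator

section Centralizer

open CliffordAlgebra

theorem ι_mul_sub_involute_mul_ι {R V : Type*} [CommRing R] [AddCommGroup V] [Module R V]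
    {Q : QuadraticForm R V} (v : V) (x : CliffordAlgebra Q) :
    ι Q v * x - involute x * ι Q v = contractLeft (Q.polarBilin v) x := by
  induction x using CliffordAlgebra.left_induction with
  | algebraMap r =>
    rw [contractLeft_algebraMap, AlgHom.commutes, Algebra.commutes, sub_self]
  | add x y hx hy =>
    rw [map_add, map_add, ← hx, ← hy]
    noncomm_ring
  | ι_mul x w hx =>
    have hswap : ι Q v * ι Q w = algebraMap R _ (QuadraticMap.polar Q v w) - ι Q w * ι Q v :=
      eq_sub_of_add_eq (ι_mul_ι_add_swap v w)
    rw [contractLeft_ι_mul, ← hx, map_mul, involute_ι, ← mul_assoc, hswap, sub_mul, mul_sub,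
      QuadraticMap.polarBilin_apply_apply, Algebra.smul_def]
    noncomm_ring

variable {K V κ : Type*} [Field K] [CharZero K] [AddCommGroup V] [Module K V] [Finite κ]
  {Q : QuadraticForm K V}

theorem exists_eq_algebraMap_of_commute_ι (b : Module.Basis κ K V)
    (hQ : Function.Surjective Q.polarBilin) {x : CliffordAlgebra Q} (hx : involute x = x)
    (h : ∀ v, Commute (ι Q v) x) : ∃ r : K, x = algebraMap K _ r := by
  let _ : Invertible (2 : K) := invertibleOfNonzero two_ne_zero
  have hcontract : ∀ d, contractLeft d x = 0 := fun d => by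
    obtain ⟨v, rfl⟩ := hQ d
    rw [← ι_mul_sub_involute_mul_ι, hx, (h v).eq, sub_self]
  obtain ⟨r, hr⟩ := exists_eq_algebraMap_of_contractLeft_eq_zero b (x := equivExterior Q x)
    fun d => by
      have hform := changeForm_contractLeft changeForm.associated_neg_proof d x
      rw [hcontract, map_zero] at hform
      exact hform.symm
  refine ⟨r, (equivExterior Q).injective ?_⟩
  rw [hr]
  exact (changeForm_algebraMap changeForm.associated_neg_proof r).symm

end Centralizer

/-! ### Isometries as products of reflections -/

section Reflections

open QuadraticMap

variable {K V : Type*} [Field K] [AddCommGroup V] [Module K V] (Q : QuadraticForm K V)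

/-- The reflection in a vector `v` with `Q v ≠ 0`; the identity if `Q v = 0`. -/
def quadReflection (v : V) : Module.End K V :=
  Module.preReflection v ((Q v)⁻¹ • Q.polarBilin v)

/-- The monoid of products of reflections. -/
def reflectionMonoid : Submonoid (Module.End K V) :=
  Submonoid.closure {R | ∃ v, Q v ≠ 0 ∧ R = quadReflection Q v}

variable {Q} {v w : V}

theorem quadReflection_apply (v w : V) :
    quadReflection Q v w = w - ((Q v)⁻¹ * polar Q v w) • v := rfl

theorem quadReflection_mem_reflectionMonoid (hv : Q v ≠ 0) :
    quadReflection Q v ∈ reflectionMonoid Q :=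
  Submonoid.subset_closure ⟨v, hv, rfl⟩

theorem quadReflection_apply_of_polar_eq_zero (h : polar Q v w = 0) : quadReflection Q v w = w := by
  rw [quadReflection_apply, h, mul_zero, zero_smul, sub_zero]

theorem quadReflection_smul {c : K} (hc : c ≠ 0) (v : V) :
    quadReflection Q (c • v) = quadReflection Q v := by
  refine LinearMap.ext fun w => ?_
  rw [quadReflection_apply, quadReflection_apply, QuadraticMap.map_smul, polar_smul_left, smul_smul]
  simp only [smul_eq_mul]
  congr 2
  field_simp

theorem map_quadReflection (hv : Q v ≠ 0) (w : V) : Q (quadReflection Q v w) = Q w := by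
  rw [quadReflection_apply, sub_eq_add_neg, ← neg_smul, QuadraticMap.map_add Q,
    QuadraticMap.map_smul, polar_smul_right, polar_comm Q w v]
  simp only [smul_eq_mul]
  field_simp
  ring

theorem map_apply_of_mem_reflectionMonoid {R : Module.End K V} (hR : R ∈ reflectionMonoid Q)
    (w : V) : Q (R w) = Q w := by
  induction hR using Submonoid.closure_induction generalizing w with
  | mem R hR =>
    obtain ⟨v, hv, rfl⟩ := hR
    exact map_quadReflection hv w
  | one => rfl
  | mul R T _ _ hR hT => exact (hR (T w)).trans (hT w)

theorem map_sub_add_map_add (Q : QuadraticForm K V) (v w : V) :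
    Q (v - w) + Q (v + w) = 2 * (Q v + Q w) := by
  rw [sub_eq_add_neg, QuadraticMap.map_add Q, QuadraticMap.map_add Q, QuadraticMap.map_neg,
    polar_neg_right]
  ring

theorem quadReflection_sub_apply (h : Q v = Q w) (hvw : Q (v - w) ≠ 0) :
    quadReflection Q (v - w) v = w := by
  have hpolar : polar Q (v - w) v = Q (v - w) := by
    rw [polar_sub_left, polar_self, sub_eq_add_neg v w, QuadraticMap.map_add Q,
      QuadraticMap.map_neg, polar_neg_right, polar_comm Q w v, ← h, two_smul]
    ring
  rw [quadReflection_apply, hpolar, inv_mul_cancel₀ hvw, one_smul, sub_sub_cancel]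

theorem quadReflection_self (hv : Q v ≠ 0) : quadReflection Q v v = -v := by
  rw [quadReflection_apply, polar_self, nsmul_eq_mul, Nat.cast_ofNat, mul_left_comm,
    inv_mul_cancel₀ hv]
  module

/-- One of the vectors `v - w` and `v + w` is anisotropic; reflecting in `v - w` takes `v` to `w`,
while reflecting in `v + w` takes `v` to `-w`. -/
theorem exists_mem_reflectionMonoid_apply_eq [NeZero (2 : K)] (h : Q v = Q w) (hv : Q v ≠ 0) :
    ∃ R ∈ reflectionMonoid Q, R v = w ∧
      ∀ z, polar Q v z = 0 → polar Q w z = 0 → R z = z := by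
  by_cases hsub : Q (v - w) = 0
  · have hw : Q w ≠ 0 := h ▸ hv
    have hadd : Q (v - -w) ≠ 0 := by
      have h4 := map_sub_add_map_add Q v w
      rw [hsub, zero_add, ← h, ← two_mul, ← sub_neg_eq_add] at h4
      rw [h4]
      exact mul_ne_zero two_ne_zero (mul_ne_zero two_ne_zero hv)
    refine ⟨quadReflection Q w * quadReflection Q (v - -w), mul_mem
      (quadReflection_mem_reflectionMonoid hw) (quadReflection_mem_reflectionMonoid hadd), ?_,
      fun z hvz hwz => ?_⟩
    · rw [Module.End.mul_apply, quadReflection_sub_apply (by rwa [QuadraticMap.map_neg]) hadd,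
        map_neg, quadReflection_self hw, neg_neg]
    · rw [Module.End.mul_apply, quadReflection_apply_of_polar_eq_zero (v := v - -w),
        quadReflection_apply_of_polar_eq_zero hwz]
      rw [polar_sub_left, polar_neg_left, hvz, hwz, neg_zero, sub_zero]
  · refine ⟨_, quadReflection_mem_reflectionMonoid hsub, quadReflection_sub_apply h hsub,
      fun z hvz hwz => quadReflection_apply_of_polar_eq_zero ?_⟩
    rw [polar_sub_left, hvz, hwz, sub_zero]

variable [NeZero (2 : K)] {κ : Type*} {b : κ → V}

theorem exists_mem_reflectionMonoid_fixing (hb : ∀ i, Q (b i) ≠ 0)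
    (horth : Pairwise fun i j => polar Q (b i) (b j) = 0) {S : Module.End K V}
    (hS : ∀ w, Q (S w) = Q w) (s : Finset κ) :
    ∃ R ∈ reflectionMonoid Q, ∀ i ∈ s, R (S (b i)) = b i := by
  classical
  induction s using Finset.induction_on with
  | empty => exact ⟨1, one_mem _, by simp⟩
  | insert j s hj ih =>
    obtain ⟨R, hR, hfix⟩ := ih
    have hRS : ∀ w, Q (R (S w)) = Q w := fun w =>
      (map_apply_of_mem_reflectionMonoid hR _).trans (hS w)
    obtain ⟨T, hT, hTj, hTorth⟩ := exists_mem_reflectionMonoid_apply_eq (hRS (b j))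
      ((hRS (b j)).trans_ne (hb j))
    refine ⟨T * R, mul_mem hT hR, fun i hi => ?_⟩
    rcases Finset.mem_insert.1 hi with rfl | hi
    · exact hTj
    · have hji : polar Q (b j) (b i) = 0 := horth (ne_of_mem_of_not_mem hi hj).symm
      rw [Module.End.mul_apply, hfix i hi, hTorth (b i) _ hji]
      rw [← hji]
      nth_rw 1 [← hfix i hi]
      simp only [polar, ← map_add, hRS]

/-- The Cartan–Dieudonné theorem. -/
theorem isometryEquiv_mem_reflectionMonoid [Finite κ] (hspan : Submodule.span K (Set.range b) = ⊤)
    (hb : ∀ i, Q (b i) ≠ 0) (horth : Pairwise fun i j => polar Q (b i) (b j) = 0)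
    (S : Q.IsometryEquiv Q) : (S.toLinearEquiv : Module.End K V) ∈ reflectionMonoid Q := by
  have := Fintype.ofFinite κ
  obtain ⟨R, hR, hfix⟩ := exists_mem_reflectionMonoid_fixing hb horth
    (S := S.symm.toLinearEquiv.toLinearMap) S.symm.map_app Finset.univ
  have hRS : R ∘ₗ S.symm.toLinearEquiv.toLinearMap = LinearMap.id :=
    LinearMap.ext_on_range hspan fun i => hfix i (Finset.mem_univ i)
  convert hR
  refine LinearMap.ext fun w => ?_
  rw [← S.symm_apply_apply w]
  exact (congrArg S (S.symm_apply_apply w)).trans (DFunLike.congr_fun hRS (S w)).symm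

end Reflections

/-! ### Spin groups and isometries -/

section SpinAction

open CliffordAlgebra

variable {K V : Type*} [Field K] [NeZero (2 : K)] [AddCommGroup V] [Module K V]
  {Q : QuadraticForm K V}

theorem ι_injective_of_two_ne_zero : Function.Injective (ι Q) := by
  let _ : Invertible (2 : K) := invertibleOfNonzero two_ne_zero
  refine Function.Injective.of_comp (f := equivExterior Q) ?_
  rw [show equivExterior Q ∘ ι Q = ExteriorAlgebra.ι K from
    funext fun v => changeForm_ι changeForm.associated_neg_proof v]
  exact ExteriorAlgebra.ι_leftInverse.injective

theorem exists_mul_ι_mul_star_of_mem_spinGroup {x : CliffordAlgebra Q} (hx : x ∈ spinGroup Q)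
    (v : V) : ∃ w, x * ι Q v * star x = ι Q w ∧ Q w = Q v := by
  let _ : Invertible (2 : K) := invertibleOfNonzero two_ne_zero
  obtain ⟨w, hw⟩ := spinGroup.conjAct_smul_ι_mem_range_ι (x := spinGroup.toUnits ⟨x, hx⟩) hx v
  replace hw : x * ι Q v * star x = ι Q w := hw.symm
  refine ⟨w, hw, (algebraMap K (CliffordAlgebra Q)).injective ?_⟩
  calc algebraMap K _ (Q w) = x * ι Q v * (star x * x) * ι Q v * star x := by
        rw [← ι_sq_scalar, ← hw]
        noncomm_ring
    _ = x * (ι Q v * ι Q v) * star x := by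
        rw [spinGroup.star_mul_self_of_mem hx]
        noncomm_ring
    _ = algebraMap K _ (Q v) := by
        rw [ι_sq_scalar, ← Algebra.commutes, mul_assoc, spinGroup.mul_star_self_of_mem hx, mul_one]

theorem exists_isometryEquiv_of_mem_spinGroup {x : CliffordAlgebra Q} (hx : x ∈ spinGroup Q) :
    ∃ S : Q.IsometryEquiv Q, ∀ v, x * ι Q v * star x = ι Q (S v) := by
  choose S hS hQ using exists_mul_ι_mul_star_of_mem_spinGroup hx
  choose T hT _ using exists_mul_ι_mul_star_of_mem_spinGroup (spinGroup.star_mem hx)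
  refine ⟨⟨⟨⟨⟨S, fun v w => ι_injective_of_two_ne_zero (Q := Q) ?_⟩,
    fun r v => ι_injective_of_two_ne_zero (Q := Q) ?_⟩, T,
    fun v => ι_injective_of_two_ne_zero (Q := Q) ?_,
    fun v => ι_injective_of_two_ne_zero (Q := Q) ?_⟩, hQ⟩, hS⟩
  · rw [map_add, ← hS, ← hS, ← hS, map_add, mul_add, add_mul]
  · rw [RingHom.id_apply, map_smul, ← hS, ← hS, map_smul, mul_smul_comm, smul_mul_assoc]
  · change ι Q (T (S v)) = ι Q v
    rw [← hT, ← hS, star_star]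
    calc star x * (x * ι Q v * star x) * x = star x * x * ι Q v * (star x * x) := by noncomm_ring
      _ = ι Q v := by rw [spinGroup.star_mul_self_of_mem hx, one_mul, mul_one]
  · change ι Q (S (T v)) = ι Q v
    rw [← hS, ← hT, star_star]
    calc x * (star x * ι Q v * x) * star x = x * star x * ι Q v * (x * star x) := by noncomm_ring
      _ = ι Q v := by rw [spinGroup.mul_star_self_of_mem hx, one_mul, mul_one]

end SpinAction

section ReflectionLift

open CliffordAlgebra

variable {V : Type*} [AddCommGroup V] [Module ℝ V] {Q : QuadraticForm ℝ V}
  {u u' : CliffordAlgebra Q} {R R' : Module.End ℝ V} {v : V}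

/-- `u` belongs to the Lipschitz group, is homogeneous, has spinor norm `±1`, and acts on vectors
as `R` through the twisted adjoint action. -/
structure IsReflectionLift (u : CliffordAlgebra Q) (R : Module.End ℝ V) : Prop where
  mem_lipschitz : u ∈ (lipschitzGroup Q).toSubmonoid.map (Units.coeHom <| CliffordAlgebra Q)
  homogeneous : ∃ i, u ∈ evenOdd Q i
  star_mul_self : ∃ ε : ℤˣ, star u * u = ε • 1
  twisted : ∀ w, involute u * ι Q w = ι Q (R w) * u

namespace IsReflectionLift

theorem one : IsReflectionLift (1 : CliffordAlgebra Q) 1 where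
  mem_lipschitz := one_mem _
  homogeneous := ⟨0, SetLike.GradedOne.one_mem (A := evenOdd Q)⟩
  star_mul_self := ⟨1, by rw [star_one, one_mul, one_smul]⟩
  twisted w := by rw [map_one, one_mul, mul_one, Module.End.one_apply]

theorem mul (h : IsReflectionLift u R) (h' : IsReflectionLift u' R') :
    IsReflectionLift (u * u') (R * R') where
  mem_lipschitz := mul_mem h.mem_lipschitz h'.mem_lipschitz
  homogeneous := by
    obtain ⟨i, hi⟩ := h.homogeneous
    obtain ⟨j, hj⟩ := h'.homogeneous
    exact ⟨i + j, SetLike.mul_mem_graded hi hj⟩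
  star_mul_self := by
    obtain ⟨ε, hε⟩ := h.star_mul_self
    obtain ⟨δ, hδ⟩ := h'.star_mul_self
    refine ⟨ε * δ, ?_⟩
    calc star (u * u') * (u * u') = star u' * (star u * u) * u' := by
          rw [star_mul]
          noncomm_ring
      _ = (ε * δ) • 1 := by rw [hε, mul_smul_comm, mul_one, smul_mul_assoc, hδ, mul_smul]
  twisted w := by
    rw [map_mul, mul_assoc, h'.twisted, ← mul_assoc, h.twisted, mul_assoc, Module.End.mul_apply]

theorem of_vector {ε : ℤˣ} (hv : Q v = (ε : ℤ)) :
    IsReflectionLift (ι Q v) (quadReflection Q v) where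
  mem_lipschitz := by
    have hQv : IsUnit (Q v) := hv ▸ (ε.isUnit.map (Int.castRingHom ℝ))
    obtain ⟨u, hu⟩ := isUnit_ι_of_isUnit Q hQv
    exact ⟨u, Subgroup.subset_closure ⟨v, hu.symm⟩, hu⟩
  homogeneous := ⟨1, ι_mem_evenOdd_one Q v⟩
  star_mul_self := ⟨-ε, by
    rw [star_ι, neg_mul, ι_sq_scalar, hv, map_intCast, Units.smul_def, zsmul_one, Units.val_neg,
      Int.cast_neg]⟩
  twisted w := by
    have hQv : Q v ≠ 0 := hv ▸ Int.cast_ne_zero.2 ε.ne_zero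
    have hswap : ι Q v * ι Q w = algebraMap ℝ _ (QuadraticMap.polar Q v w) - ι Q w * ι Q v :=
      eq_sub_of_add_eq (ι_mul_ι_add_swap v w)
    rw [involute_ι, neg_mul, hswap, quadReflection_apply, map_sub, map_smul, sub_mul,
      smul_mul_assoc, ι_sq_scalar, Algebra.smul_def, ← map_mul (algebraMap ℝ _), mul_right_comm,
      inv_mul_cancel₀ hQv, one_mul, neg_sub]

theorem mul_self_mem_spinGroup (h : IsReflectionLift u R) : u * u ∈ spinGroup Q := by
  obtain ⟨ε, hε⟩ := h.star_mul_self
  have hstar : star (u * u) * (u * u) = 1 := by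
    calc star (u * u) * (u * u) = star u * (star u * u) * u := by
          rw [star_mul]
          noncomm_ring
      _ = 1 := by
          rw [hε, mul_smul_comm, mul_one, smul_mul_assoc, hε, smul_smul, Int.units_mul_self,
            one_smul]
  have hlip := mul_mem h.mem_lipschitz h.mem_lipschitz
  obtain ⟨i, hi⟩ := h.homogeneous
  refine ⟨⟨hlip, hstar, ?_⟩, ?_⟩
  · obtain ⟨g, -, hg⟩ := hlip
    rw [← hg] at hstar ⊢
    rw [← Units.inv_eq_of_mul_eq_one_left hstar]
    exact g.mul_inv
  · have heven := SetLike.mul_mem_graded hi hi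
    rwa [CharTwo.add_self_eq_zero] at heven

end IsReflectionLift

theorem exists_isReflectionLift (hR : R ∈ reflectionMonoid Q) :
    ∃ u : CliffordAlgebra Q, IsReflectionLift u R := by
  induction hR using Submonoid.closure_induction with
  | mem R hR =>
    obtain ⟨v, hv, rfl⟩ := hR
    have hc : (√|Q v|)⁻¹ ≠ 0 := inv_ne_zero (Real.sqrt_ne_zero'.2 (abs_pos.2 hv))
    rw [← quadReflection_smul hc]
    have hnorm : Q ((√|Q v|)⁻¹ • v) = |Q v|⁻¹ * Q v := by
      rw [QuadraticMap.map_smul, ← mul_inv, Real.mul_self_sqrt (abs_nonneg _), smul_eq_mul]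
    rcases hv.lt_or_gt with hneg | hpos
    · refine ⟨_, .of_vector (ε := -1) (hnorm.trans ?_)⟩
      rw [abs_of_neg hneg, inv_neg, neg_mul, inv_mul_cancel₀ hv]
      norm_num
    · refine ⟨_, .of_vector (ε := 1) (hnorm.trans ?_)⟩
      rw [abs_of_pos hpos, inv_mul_cancel₀ hv]
      norm_num
  | one => exact ⟨1, .one⟩
  | mul R T _ _ hR hT =>
    obtain ⟨u, hu⟩ := hR
    obtain ⟨u', hu'⟩ := hT
    exact ⟨u * u', hu.mul hu'⟩

/-- Squaring makes the lift of an isometry even and its spinor norm equal to `1`. -/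
theorem exists_mem_spinGroup_sq_of_mem_reflectionMonoid (hR : R ∈ reflectionMonoid Q) :
    ∃ x ∈ spinGroup Q, ∀ v, x * ι Q v * star x = ι Q (R (R v)) := by
  obtain ⟨u, hu⟩ := exists_isReflectionLift hR
  have hx := hu.mul_self_mem_spinGroup
  refine ⟨u * u, hx, fun v => ?_⟩
  have htwisted := (hu.mul hu).twisted v
  rw [spinGroup.involute_eq hx, Module.End.mul_apply] at htwisted
  rw [htwisted, mul_assoc, spinGroup.mul_star_self_of_mem hx, mul_one]

end ReflectionLift

/-! ### Half-spin representations -/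

section ChiralPair

open CliffordAlgebra

variable {K V 𝔸 : Type*} [Field K] [AddCommGroup V] [Module K V] [Ring 𝔸] [Algebra K 𝔸]

/-- The chiral gamma matrices. -/
def gamma (H H' : V →ₗ[K] 𝔸) : V →ₗ[K] Matrix (Fin 2) (Fin 2) 𝔸 where
  toFun v := !![0, H v; H' v, 0]
  map_add' v w := by simp
  map_smul' r v := by simp

theorem algebraMap_fin_two (r : K) :
    algebraMap K (Matrix (Fin 2) (Fin 2) 𝔸) r = !![algebraMap K 𝔸 r, 0; 0, algebraMap K 𝔸 r] := by
  ext i j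
  fin_cases i <;> fin_cases j <;> simp [Matrix.algebraMap_matrix_apply]

variable [StarRing 𝔸]

/-- The pairs `H`, `H'` of self-adjoint linear maps for which the chiral gamma matrices
`(0 H; H' 0)` satisfy the Clifford relation for `Q`. -/
structure IsChiralPair (Q : QuadraticForm K V) (H H' : V →ₗ[K] 𝔸) : Prop where
  mul_dual : ∀ v, H v * H' v = algebraMap K 𝔸 (Q v)
  dual_mul : ∀ v, H' v * H v = algebraMap K 𝔸 (Q v)
  star_left : ∀ v, star (H v) = H v
  star_right : ∀ v, star (H' v) = H' v

namespace IsChiralPair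

variable {Q : QuadraticForm K V} {H H' : V →ₗ[K] 𝔸}

theorem gamma_mul_self (h : IsChiralPair Q H H') (v : V) :
    gamma H H' v * gamma H H' v = algebraMap K _ (Q v) := by
  change !![0, H v; H' v, 0] * !![0, H v; H' v, 0] = _
  simp only [Matrix.mul_fin_two, h.mul_dual, h.dual_mul, algebraMap_fin_two, zero_mul, mul_zero,
    add_zero, zero_add]

theorem comp_isometryEquiv {V' : Type*} [AddCommGroup V'] [Module K V'] {Q' : QuadraticForm K V'}
    (h : IsChiralPair Q H H') (e : Q'.IsometryEquiv Q) :
    IsChiralPair Q' (H ∘ₗ e.toLinearEquiv) (H' ∘ₗ e.toLinearEquiv) where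
  mul_dual v := (h.mul_dual (e v)).trans (congrArg _ (e.map_app v))
  dual_mul v := (h.dual_mul (e v)).trans (congrArg _ (e.map_app v))
  star_left v := h.star_left (e v)
  star_right v := h.star_right (e v)

/-- The action of the Clifford algebra on pairs of half-spinors. -/
def spinorRep (h : IsChiralPair Q H H') : CliffordAlgebra Q →ₐ[K] Matrix (Fin 2) (Fin 2) 𝔸 :=
  CliffordAlgebra.lift Q ⟨gamma H H', h.gamma_mul_self⟩

variable (h : IsChiralPair Q H H')

theorem spinorRep_ι (v : V) : h.spinorRep (ι Q v) = !![0, H v; H' v, 0] :=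
  lift_ι_apply _ h.gamma_mul_self v

theorem spinorRep_involute (x : CliffordAlgebra Q) :
    h.spinorRep (involute x) =
      !![h.spinorRep x 0 0, -h.spinorRep x 0 1; -h.spinorRep x 1 0, h.spinorRep x 1 1] := by
  induction x using CliffordAlgebra.induction with
  | algebraMap r => simp [algebraMap_fin_two]
  | ι v => simp [spinorRep_ι]
  | mul x y hx hy => simp [hx, hy, Matrix.mul_apply, Fin.sum_univ_two, add_comm]
  | add x y hx hy => simp [hx, hy, add_comm]

section EvenElements

variable [NeZero (2 : K)] {x y : CliffordAlgebra Q}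

theorem spinorRep_off_diag (hx : involute x = x) :
    h.spinorRep x 0 1 = 0 ∧ h.spinorRep x 1 0 = 0 := by
  have eq_zero : ∀ a : 𝔸, a = -a → a = 0 := fun a ha => by
    have htwo : (2 : K) • a = 0 := by rw [two_smul]; exact add_eq_zero_iff_eq_neg.2 ha
    exact (smul_eq_zero_iff_right two_ne_zero).1 htwo
  have hinv := h.spinorRep_involute x
  rw [hx] at hinv
  exact ⟨eq_zero _ (congrFun (congrFun hinv 0) 1), eq_zero _ (congrFun (congrFun hinv 1) 0)⟩

theorem spinorRep_mul_zero_zero (hx : involute x = x) :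
    h.spinorRep (x * y) 0 0 = h.spinorRep x 0 0 * h.spinorRep y 0 0 := by
  rw [map_mul, Matrix.mul_apply, Fin.sum_univ_two, (h.spinorRep_off_diag hx).1, zero_mul, add_zero]

theorem spinorRep_mul_one_one (hx : involute x = x) :
    h.spinorRep (x * y) 1 1 = h.spinorRep x 1 1 * h.spinorRep y 1 1 := by
  rw [map_mul, Matrix.mul_apply, Fin.sum_univ_two, (h.spinorRep_off_diag hx).2, zero_mul, zero_add]

/-- The half-spin representation, on the upper component of the spinors. -/
def halfSpin : spinGroup Q →* 𝔸ˣ :=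
  MonoidHom.toHomUnits
    { toFun := fun g => h.spinorRep g 0 0
      map_one' := by simp
      map_mul' := fun g _ => h.spinorRep_mul_zero_zero (spinGroup.involute_eq g.2) }

theorem halfSpin_apply (g : spinGroup Q) : (h.halfSpin g : 𝔸) = h.spinorRep g 0 0 := rfl

end EvenElements

variable [StarRing K] [TrivialStar K] [StarModule K 𝔸]

theorem spinorRep_reverse (x : CliffordAlgebra Q) :
    h.spinorRep (reverse x) =
      !![star (h.spinorRep x 1 1), star (h.spinorRep x 0 1);
        star (h.spinorRep x 1 0), star (h.spinorRep x 0 0)] := by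
  induction x using CliffordAlgebra.induction with
  | algebraMap r => simp [algebraMap_fin_two, ← algebraMap_star_comm]
  | ι v => simp [spinorRep_ι, h.star_left, h.star_right]
  | mul x y hx hy => simp [hx, hy, Matrix.mul_apply, Fin.sum_univ_two, add_comm]
  | add x y hx hy => simp [hx, hy]

section InvertibleTwo

variable [NeZero (2 : K)]

theorem spinorRep_mul_star_halfSpin (g : spinGroup Q) :
    h.spinorRep g 1 1 * star (h.halfSpin g : 𝔸) = 1 := by
  have hg := spinGroup.involute_eq g.2
  have hmul := congrFun (congrFun
    (congrArg h.spinorRep (spinGroup.mul_star_self_of_mem g.2)) 1) 1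
  rwa [h.spinorRep_mul_one_one hg, CliffordAlgebra.star_def, hg, spinorRep_reverse, map_one]
    at hmul

theorem halfSpin_mul_mul_star {g : spinGroup Q} {v w : V}
    (hvw : (g : CliffordAlgebra Q) * ι Q v * star (g : CliffordAlgebra Q) = ι Q w) :
    (h.halfSpin g : 𝔸) * H v * star (h.halfSpin g : 𝔸) = H w := by
  have hcomm : (g : CliffordAlgebra Q) * ι Q v = ι Q w * g := by
    rw [← hvw, mul_assoc, spinGroup.star_mul_self_of_mem g.2, mul_one]
  have hblock : (h.halfSpin g : 𝔸) * H v = H w * h.spinorRep g 1 1 := by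
    have := congrFun (congrFun (congrArg h.spinorRep hcomm) 0) 1
    simpa [spinorRep_ι, halfSpin_apply, Matrix.mul_apply, Fin.sum_univ_two] using this
  rw [hblock, mul_assoc, h.spinorRep_mul_star_halfSpin, mul_one]

end InvertibleTwo

theorem halfSpin_injective {κ : Type*} [Finite κ] [CharZero K] [Nontrivial 𝔸]
    (b : Module.Basis κ K V) (hQ : Function.Surjective Q.polarBilin)
    (hH : Function.Injective H) : Function.Injective h.halfSpin := by
  rw [injective_iff_map_eq_one]
  intro g hg
  have hcomm : ∀ v, Commute (ι Q v) (g : CliffordAlgebra Q) := fun v => by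
    obtain ⟨S, hS⟩ := exists_isometryEquiv_of_mem_spinGroup g.2
    have hSv := h.halfSpin_mul_mul_star (hS v)
    rw [hg, Units.val_one, star_one, one_mul, mul_one] at hSv
    have hconj := hS v
    rw [← hH hSv] at hconj
    calc ι Q v * g = g * ι Q v * (star (g : CliffordAlgebra Q) * g) := by
          rw [← mul_assoc, hconj]
      _ = g * ι Q v := by rw [spinGroup.star_mul_self_of_mem g.2, mul_one]
  obtain ⟨r, hr⟩ := exists_eq_algebraMap_of_commute_ι b hQ (spinGroup.involute_eq g.2) hcomm
  have hr1 : algebraMap K 𝔸 r = 1 := by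
    have := congrArg Units.val hg
    rwa [halfSpin_apply, hr, AlgHom.commutes, algebraMap_fin_two] at this
  refine Subtype.ext ?_
  rw [hr, (algebraMap K 𝔸).injective (hr1.trans (map_one _).symm), map_one]
  rfl

end IsChiralPair
end ChiralPair

/-! ### The image of the half-spin representation -/

section Continuity

open CliffordAlgebra

variable {V 𝔸 : Type*} [AddCommGroup V] [Module ℝ V] {Q : QuadraticForm ℝ V}

theorem continuous_star_cliffordAlgebra : Continuous fun x : CliffordAlgebra Q => star x := by
  have : IsModuleTopology ℝ (CliffordAlgebra Q) := ⟨rfl⟩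
  have := IsModuleTopology.toContinuousAdd ℝ (CliffordAlgebra Q)
  exact IsModuleTopology.continuous_of_linearMap
    (reverse (Q := Q) ∘ₗ (involute (Q := Q)).toLinearMap)

variable [Ring 𝔸] [Algebra ℝ 𝔸] [StarRing 𝔸] [TopologicalSpace 𝔸] [ContinuousAdd 𝔸]
  [ContinuousSMul ℝ 𝔸] {H H' : V →ₗ[ℝ] 𝔸}

theorem IsChiralPair.continuous_halfSpin (h : IsChiralPair Q H H') : Continuous h.halfSpin := by
  have : IsModuleTopology ℝ (CliffordAlgebra Q) := ⟨rfl⟩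
  have hval : Continuous fun x : CliffordAlgebra Q => h.spinorRep x 0 0 :=
    IsModuleTopology.continuous_of_linearMap
      (Matrix.entryLinearMap ℝ 𝔸 0 0 ∘ₗ h.spinorRep.toLinearMap)
  refine Units.continuous_iff.2 ⟨hval.comp continuous_subtype_val, ?_⟩
  refine (hval.comp (continuous_star_cliffordAlgebra.comp continuous_subtype_val)).congr fun g => ?_
  rw [← map_inv]
  rfl

end Continuity

section Image

theorem mul_star_eq_one_and_commute_of_mul_mul_star_eq {𝔸 E : Type*} [Monoid 𝔸] [StarMul 𝔸]
    {H : E → 𝔸} (hone : 1 ∈ Set.range H) {k : 𝔸ˣ}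
    (hk : ∀ w, (k : 𝔸) * H w * star (k : 𝔸) = H w) :
    (k : 𝔸) * star (k : 𝔸) = 1 ∧ ∀ w, Commute (k : 𝔸) (H w) := by
  have hstar : (k : 𝔸) * star (k : 𝔸) = 1 := by
    obtain ⟨w, hw⟩ := hone
    simpa only [hw, mul_one] using hk w
  have hstar' : star (k : 𝔸) * (k : 𝔸) = 1 := by
    rw [← Units.inv_eq_of_mul_eq_one_right hstar, k.inv_mul]
  refine ⟨hstar, fun w => ?_⟩
  calc (k : 𝔸) * H w = k * H w * (star (k : 𝔸) * k) := by rw [hstar', mul_one]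
    _ = H w * k := by rw [← mul_assoc, hk]

theorem sq_eq_one_and_commute_of_mul_mul_star_eq {𝔸 E : Type*} [Ring 𝔸] [Algebra ℝ 𝔸] [StarRing 𝔸]
    [StarModule ℝ 𝔸] {H : E → 𝔸} (hone : 1 ∈ Set.range H)
    (hcentral : Subalgebra.centralizer ℝ (Set.range H) = ⊥) {k : 𝔸ˣ}
    (hk : ∀ w, (k : 𝔸) * H w * star (k : 𝔸) = H w) :
    k ^ 2 = 1 ∧ ∀ g : 𝔸ˣ, Commute g k := by
  obtain ⟨hstar, hcomm⟩ := mul_star_eq_one_and_commute_of_mul_mul_star_eq hone hk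
  have hmem : (k : 𝔸) ∈ Subalgebra.centralizer ℝ (Set.range H) := by
    rintro _ ⟨w, rfl⟩
    exact (hcomm w).symm
  rw [hcentral] at hmem
  obtain ⟨r, hr⟩ := Algebra.mem_bot.1 hmem
  have hself : star (k : 𝔸) = k := by rw [← hr, ← algebraMap_star_comm, star_trivial]
  rw [hself] at hstar
  refine ⟨Units.ext (by rw [sq, Units.val_mul, hstar, Units.val_one]), fun g => Units.ext ?_⟩
  rw [Units.val_mul, Units.val_mul, ← hr]
  exact (Algebra.commutes r (g : 𝔸)).symm

variable {𝔸 E F : Type*} [NormedRing 𝔸] [NormedAlgebra ℝ 𝔸] [StarRing 𝔸]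
  [NormedAddCommGroup E] [NormedSpace ℝ E] [NormedAddCommGroup F] [NormedSpace ℝ F]
  {Q : QuadraticForm ℝ E}

theorem congruenceGroup_comp_isometryEquiv {Q' : QuadraticForm ℝ F} {H : E →L[ℝ] 𝔸}
    (e : Q'.IsometryEquiv Q) {H' : F →L[ℝ] 𝔸} (h : ∀ v, H' v = H (e v)) :
    congruenceGroup H' Q' = congruenceGroup H Q := by
  ext g
  constructor
  · rintro ⟨S, hS⟩
    refine ⟨(e.symm.trans S).trans e, fun w => ?_⟩
    obtain ⟨v, rfl⟩ := e.toLinearEquiv.surjective w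
    have := hS v
    rw [h, h] at this
    refine this.trans (congrArg (fun u => H (e (S u))) ?_)
    exact (e.symm_apply_apply v).symm
  · rintro ⟨S, hS⟩
    refine ⟨(e.trans S).trans e.symm, fun v => ?_⟩
    rw [h, h, hS]
    exact congrArg H (e.apply_symm_apply _).symm

variable {H : E →L[ℝ] 𝔸} {H' : E →ₗ[ℝ] 𝔸} [StarModule ℝ 𝔸]

namespace IsChiralPair

variable (h : IsChiralPair Q (H : E →ₗ[ℝ] 𝔸) H')

theorem range_halfSpin_le_congruenceGroup : h.halfSpin.range ≤ congruenceGroup H Q := by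
  rintro _ ⟨g, rfl⟩
  obtain ⟨S, hS⟩ := exists_isometryEquiv_of_mem_spinGroup g.2
  exact ⟨S, fun w => h.halfSpin_mul_mul_star (hS w)⟩

variable {κ : Type*} [Finite κ] {b : κ → E}

/-- The spin element lifting the square of the isometry induced by `g` differs from `g ^ 2` by an
operator that commutes with the range of `H`, that is, by a sign. -/
theorem pow_four_mem_range_halfSpin (hspan : Submodule.span ℝ (Set.range b) = ⊤)
    (hb : ∀ i, Q (b i) ≠ 0) (horth : Pairwise fun i j => QuadraticMap.polar Q (b i) (b j) = 0)
    (hone : 1 ∈ Set.range H) (hcentral : Subalgebra.centralizer ℝ (Set.range H) = ⊥) {g : 𝔸ˣ}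
    (hg : g ∈ congruenceGroup H Q) : g ^ 4 ∈ h.halfSpin.range := by
  obtain ⟨S, hS⟩ := hg
  obtain ⟨x, hx, hxS⟩ := exists_mem_spinGroup_sq_of_mem_reflectionMonoid
    (isometryEquiv_mem_reflectionMonoid hspan hb horth S)
  set y : 𝔸ˣ := h.halfSpin ⟨x, hx⟩
  have hy : ∀ w, (y : 𝔸) * H w * star (y : 𝔸) = (g ^ 2 : 𝔸ˣ) * H w * star ((g ^ 2 : 𝔸ˣ) : 𝔸) :=
    fun w => by
      refine (h.halfSpin_mul_mul_star (hxS w)).trans ?_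
      calc H (S (S w)) = g * (g * H w * star (g : 𝔸)) * star (g : 𝔸) := by rw [hS, hS]
        _ = _ := by rw [sq, Units.val_mul, star_mul]; noncomm_ring
  set k : 𝔸ˣ := y⁻¹ * g ^ 2
  have hyk : g ^ 2 = y * k := (mul_inv_cancel_left y (g ^ 2)).symm
  have hk : ∀ w, (k : 𝔸) * H w * star (k : 𝔸) = H w := fun w => by
    have hyw := hy w
    rw [hyk, Units.val_mul, star_mul] at hyw
    refine y.isUnit.mul_left_cancel (y.isUnit.star.mul_right_cancel ?_)
    rw [hyw]
    noncomm_ring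
  obtain ⟨hk2, hcomm⟩ := sq_eq_one_and_commute_of_mul_mul_star_eq hone hcentral hk
  refine ⟨⟨x, hx⟩ ^ 2, ?_⟩
  calc h.halfSpin (⟨x, hx⟩ ^ 2) = y ^ 2 * k ^ 2 := by rw [map_pow, hk2, mul_one]
    _ = (g ^ 2) ^ 2 := by rw [hyk, (hcomm y).mul_pow]
    _ = g ^ 4 := (pow_mul g 2 2).symm

theorem lieAlgebraOf_range_halfSpin [CompleteSpace 𝔸]
    (hspan : Submodule.span ℝ (Set.range b) = ⊤)
    (hb : ∀ i, Q (b i) ≠ 0) (horth : Pairwise fun i j => QuadraticMap.polar Q (b i) (b j) = 0)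
    (hone : 1 ∈ Set.range H) (hcentral : Subalgebra.centralizer ℝ (Set.range H) = ⊥) :
    lieAlgebraOf h.halfSpin.range = lieAlgebraOf (congruenceGroup H Q) :=
  lieAlgebraOf_eq_of_pow_mem h.range_halfSpin_le_congruenceGroup four_ne_zero fun _ hg =>
    h.pow_four_mem_range_halfSpin hspan hb horth hone hcentral hg

end IsChiralPair
end Image

/-! ### Signature `(9, 1)` as Hermitian octonionic matrices -/

section WeightedSumSquares

theorem polarBilin_surjective_of_orthogonal {K V κ : Type*} [Field K] [NeZero (2 : K)]
    [AddCommGroup V] [Module K V] [Finite κ] {Q : QuadraticForm K V} (b : Module.Basis κ K V)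
    (hb : ∀ i, Q (b i) ≠ 0) (horth : Pairwise fun i j => QuadraticMap.polar Q (b i) (b j) = 0) :
    Function.Surjective Q.polarBilin := by
  classical
  have := Fintype.ofFinite κ
  intro d
  refine ⟨∑ i, (d (b i) / (2 * Q (b i))) • b i, b.ext fun j => ?_⟩
  simp only [map_sum, map_smul, LinearMap.sum_apply, LinearMap.smul_apply,
    QuadraticMap.polarBilin_apply_apply, smul_eq_mul]
  rw [Finset.sum_eq_single j (fun i _ hij => by rw [horth hij, mul_zero]) (by simp),
    QuadraticMap.polar_self, nsmul_eq_mul, Nat.cast_ofNat,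
    div_mul_cancel₀ _ (mul_ne_zero two_ne_zero (hb j))]

variable {R ι : Type*} [CommRing R] [Fintype ι] [DecidableEq ι] (w : ι → R)

theorem weightedSumSquares_single (i : ι) :
    QuadraticMap.weightedSumSquares R w (Pi.single i 1) = w i := by
  rw [QuadraticMap.weightedSumSquares_apply, Finset.sum_eq_single i] <;>
    simp +contextual

theorem polar_weightedSumSquares_single {i j : ι} (hij : i ≠ j) :
    QuadraticMap.polar (QuadraticMap.weightedSumSquares R w) (Pi.single i 1) (Pi.single j 1)
      = 0 := by
  have hcross : ∀ k, (Pi.single i 1 : ι → R) k * (Pi.single j 1 : ι → R) k = 0 := fun k => by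
    rcases eq_or_ne k i with rfl | hk
    · rw [Pi.single_eq_of_ne hij, mul_zero]
    · rw [Pi.single_eq_of_ne hk, zero_mul]
  simp only [QuadraticMap.polar, QuadraticMap.weightedSumSquares_apply, Pi.add_apply,
    ← Finset.sum_sub_distrib, smul_eq_mul]
  exact Finset.sum_eq_zero fun k _ => by linear_combination 2 * w k * hcross k

variable {p q : ℕ}

theorem signatureForm_basisFun_ne_zero (i : Fin p ⊕ Fin q) :
    signatureForm p q (Pi.basisFun ℝ _ i) ≠ 0 := by
  rw [Pi.basisFun_apply, signatureForm, weightedSumSquares_single]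
  rcases i with _ | _ <;> simp

theorem pairwise_polar_signatureForm_basisFun : Pairwise fun i j : Fin p ⊕ Fin q =>
    QuadraticMap.polar (signatureForm p q) (Pi.basisFun ℝ _ i) (Pi.basisFun ℝ _ j) = 0 :=
  fun i j hij => by
    simp only [Pi.basisFun_apply]
    exact polar_weightedSumSquares_single _ hij

end WeightedSumSquares

/-- The octonion with the given quaternion coordinates: the first four span the first copy of the
quaternions. -/
def octonionOfCoords : (Fin 8 → ℝ) ≃ₗ[ℝ] Octonion where
  toFun v := mk ⟨v 0, v 1, v 2, v 3⟩ ⟨v 4, v 5, v 6, v 7⟩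
  map_add' v w := by apply ext_components <;> rfl
  map_smul' r v := by apply ext_components <;> rfl
  invFun z := ![z.fst.re, z.fst.imI, z.fst.imJ, z.fst.imK, z.snd.re, z.snd.imI, z.snd.imJ,
    z.snd.imK]
  left_inv v := by ext i; fin_cases i <;> rfl
  right_inv z := by apply ext_components <;> rfl

theorem inner_octonionOfCoords_self (v : Fin 8 → ℝ) :
    inner ℝ (octonionOfCoords v) (octonionOfCoords v) = ∑ i, v i * v i := by
  rw [inner_eq, Quaternion.inner_self, Quaternion.inner_self, Quaternion.normSq_def',
    Quaternion.normSq_def', Fin.sum_univ_eight]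
  change v 0 ^ 2 + v 1 ^ 2 + v 2 ^ 2 + v 3 ^ 2 + (v 4 ^ 2 + v 5 ^ 2 + v 6 ^ 2 + v 7 ^ 2) = _
  ring

/-- The identification of `ℝ^(9,1)` with the Hermitian octonionic matrices: the last coordinate is
half the trace, and the ninth half the difference of the diagonal entries. -/
def hermEquiv : (signatureForm 9 1).IsometryEquiv hermForm where
  toFun v := (v (.inr 0) + v (.inl 8), v (.inr 0) - v (.inl 8),
    octonionOfCoords fun i => v (.inl i.castSucc))
  map_add' v w := by
    refine Prod.ext ?_ (Prod.ext ?_ (map_add octonionOfCoords _ _)) <;>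
      simp only [Pi.add_apply, Prod.fst_add, Prod.snd_add] <;> ring
  map_smul' r v := by
    refine Prod.ext ?_ (Prod.ext ?_ (map_smul octonionOfCoords r _)) <;>
      simp only [Pi.smul_apply, smul_eq_mul, RingHom.id_apply, Prod.smul_fst, Prod.smul_snd] <;>
      ring
  invFun w := Sum.elim (Fin.snoc (octonionOfCoords.symm w.2.2) ((w.1 - w.2.1) / 2))
    fun _ => (w.1 + w.2.1) / 2
  left_inv v := by
    ext (i | i)
    · refine Fin.lastCases ?_ (fun i => ?_) i
      · simp only [Sum.elim_inl, Fin.snoc_last]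
        change _ = v (.inl 8)
        ring
      · simp
    · simp [Subsingleton.elim i 0]
  right_inv w := by
    refine Prod.ext ?_ (Prod.ext ?_ ?_)
    · change (w.1 + w.2.1) / 2 + (w.1 - w.2.1) / 2 = w.1
      ring
    · change (w.1 + w.2.1) / 2 - (w.1 - w.2.1) / 2 = w.2.1
      ring
    · simp
  map_app' v := by
    change hermForm (v (.inr 0) + v (.inl 8), v (.inr 0) - v (.inl 8), octonionOfCoords _) = _
    rw [hermForm_apply, inner_octonionOfCoords_self, signatureForm,
      QuadraticMap.weightedSumSquares_apply, Fintype.sum_sum_type, Fin.sum_univ_castSucc (n := 8)]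
    simp only [Sum.elim_inl, Sum.elim_inr, Fin.reduceLast, Finset.univ_unique,
      Fin.default_eq_zero, Finset.sum_singleton, smul_eq_mul, one_mul]
    ring

/-- The linear map `X ↦ X - tr X` on Hermitian octonionic matrices: up to sign, it gives the
adjugate. -/
def hermDual : Herm2 →ₗ[ℝ] Herm2 where
  toFun w := (-w.2.1, -w.1, w.2.2)
  map_add' v w := by ext <;> simp <;> ring
  map_smul' r v := by ext <;> simp

theorem hermDual_apply (w : Herm2) : hermDual w = (-w.2.1, -w.1, w.2.2) := rfl

theorem hermDual_hermDual (w : Herm2) : hermDual (hermDual w) = w := by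
  simp [hermDual_apply]

theorem hermForm_hermDual (w : Herm2) : hermForm (hermDual w) = hermForm w := by
  rw [hermForm_apply, hermForm_apply, hermDual_apply]
  ring

theorem hermOp_mul_hermOp_hermDual (w : Herm2) :
    hermOp w * hermOp (hermDual w) = algebraMap ℝ End2 (hermForm w) := by
  have hRL : C.comp (R w.2.2) * C.comp (L w.2.2) = (inner ℝ w.2.2 w.2.2 : ℝ) • 1 := by
    ext x : 1
    change C (C (w.2.2 * x) * w.2.2) = (inner ℝ w.2.2 w.2.2 : ℝ) • x
    rw [C_mul, C_C, C_mul_mul_self]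
  have hLR : C.comp (L w.2.2) * C.comp (R w.2.2) = (inner ℝ w.2.2 w.2.2 : ℝ) • 1 := by
    ext x : 1
    change C (w.2.2 * C (x * w.2.2)) = (inner ℝ w.2.2 w.2.2 : ℝ) • x
    rw [C_mul, C_C, mul_mul_C_self]
  rw [Algebra.algebraMap_eq_smul_one, ← blockEnd_smul_one, hermOp_apply, hermOp_apply,
    hermDual_apply, blockEnd_mul, hRL, hLR, hermForm_apply, blockEnd_inj]
  simp only [smul_mul_assoc, mul_smul_comm, one_mul, mul_one]
  refine ⟨?_, ?_, ?_, ?_⟩ <;> module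

theorem isChiralPair_hermOp : IsChiralPair hermForm (hermOp : Herm2 →ₗ[ℝ] End2)
    ((hermOp : Herm2 →ₗ[ℝ] End2) ∘ₗ hermDual) where
  mul_dual := hermOp_mul_hermOp_hermDual
  dual_mul w := by
    have h := hermOp_mul_hermOp_hermDual (hermDual w)
    rwa [hermDual_hermDual, hermForm_hermDual] at h
  star_left := star_hermOp
  star_right w := star_hermOp (hermDual w)

theorem hermOp_one_one_zero : hermOp (1, 1, 0) = 1 := by
  refine ContinuousLinearMap.ext fun v => ?_
  rw [hermOp_apply, blockEnd_apply]
  simp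

theorem quaternion_eq_coe_re_of_forall_commute {q : ℍ[ℝ]} (h : ∀ b, Commute b q) : q = q.re := by
  obtain ⟨i, hi⟩ : ∃ i : ℍ[ℝ], i.re = 0 ∧ i.imI = 1 ∧ i.imJ = 0 ∧ i.imK = 0 :=
    ⟨⟨0, 1, 0, 0⟩, rfl, rfl, rfl, rfl⟩
  obtain ⟨j, hj⟩ : ∃ j : ℍ[ℝ], j.re = 0 ∧ j.imI = 0 ∧ j.imJ = 1 ∧ j.imK = 0 :=
    ⟨⟨0, 0, 1, 0⟩, rfl, rfl, rfl, rfl⟩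
  have hiJ := congrArg QuaternionAlgebra.imJ (h i).eq
  have hiK := congrArg QuaternionAlgebra.imK (h i).eq
  have hjK := congrArg QuaternionAlgebra.imK (h j).eq
  simp only [Quaternion.imJ_mul, hi] at hiJ
  simp only [Quaternion.imK_mul, hi, hj] at hiK hjK
  apply Quaternion.ext
  · rfl
  · exact show q.imI = 0 by linarith only [hjK]
  · exact show q.imJ = 0 by linarith only [hiK]
  · exact show q.imK = 0 by linarith only [hiJ]

namespace Octonion

theorem exists_eq_smul_one_of_forall_mul_assoc {c : Octonion}
    (h : ∀ x y : Octonion, (x * y) * c = x * (y * c)) : ∃ r : ℝ, c = r • (1 : Octonion) := by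
  have hsnd : c.snd = 0 := by
    by_contra hc
    have hcomm : ∀ a b : ℍ[ℝ], Commute a b := fun a b => by
      have hab : c.snd * (a * b) = c.snd * b * a := by
        simpa using congrArg snd (h (mk a 0) (mk b 0))
      rw [mul_assoc] at hab
      exact mul_left_cancel₀ hc hab
    have hreal := quaternion_eq_coe_re_of_forall_commute fun b => hcomm b ⟨0, 1, 0, 0⟩
    exact one_ne_zero (congrArg QuaternionAlgebra.imI hreal)
  have hfst : ∀ b : ℍ[ℝ], Commute b c.fst := fun b => by
    have hb : star b * star c.fst = star c.fst * star b := by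
      simpa [hsnd] using congrArg snd (h (mk 0 1) (mk b 0))
    rw [← star_mul, ← star_mul] at hb
    exact (star_injective hb).symm
  refine ⟨c.fst.re, ext_components ?_ ?_⟩
  · rw [fst_smul, fst_one, ← Algebra.algebraMap_eq_smul_one]
    exact quaternion_eq_coe_re_of_forall_commute hfst
  · rw [snd_smul, snd_one, smul_zero, hsnd]

theorem exists_eq_smul_one_of_forall_apply_mul {a : Octonion →L[ℝ] Octonion}
    (ha : ∀ z x, a (z * x) = z * a x) : ∃ r : ℝ, a = r • 1 := by
  obtain ⟨r, hr⟩ := exists_eq_smul_one_of_forall_mul_assoc (c := a 1) fun x y => by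
    rw [← ha, ← ha, ← ha, mul_one', mul_one']
  refine ⟨r, ContinuousLinearMap.ext fun x => ?_⟩
  have hx := ha x 1
  rwa [mul_one', hr, mul_smul', mul_one'] at hx

end Octonion

theorem centralizer_range_hermOp : Subalgebra.centralizer ℝ (Set.range hermOp) = ⊥ := by
  rw [eq_bot_iff]
  intro K hK
  obtain ⟨a, b, c, d, rfl⟩ := exists_eq_blockEnd K
  replace hK : ∀ w, hermOp w * blockEnd a b c d = blockEnd a b c d * hermOp w :=
    fun w => hK _ ⟨w, rfl⟩
  have hdiag := hK (1, 0, 0)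
  rw [hermOp_fst_one, blockEnd_mul, blockEnd_mul, blockEnd_inj] at hdiag
  simp only [one_mul, mul_one, zero_mul, mul_zero, add_zero] at hdiag
  obtain ⟨-, rfl, rfl, -⟩ := hdiag
  have hoff : ∀ z, C.comp (R z) * d = a * C.comp (R z) ∧
      C.comp (L z) * a = d * C.comp (L z) := fun z => by
    have h := hK (0, 0, z)
    rw [hermOp_apply, blockEnd_mul, blockEnd_mul, blockEnd_inj] at h
    simp only [zero_smul, zero_mul, mul_zero, add_zero, zero_add] at h
    exact ⟨h.2.1, h.2.2.1⟩
  have hd : ∀ y, d y = C (a (C y)) := fun y => by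
    have h : C (d y * 1) = a (C (y * 1)) := DFunLike.congr_fun (hoff 1).1 y
    rw [mul_one', mul_one'] at h
    rw [← h, C_C]
  obtain ⟨r, rfl⟩ := exists_eq_smul_one_of_forall_apply_mul (a := a) fun z x => by
    have h : C (z * a x) = d (C (z * x)) := DFunLike.congr_fun (hoff z).2 x
    rw [hd, C_C] at h
    rw [← C_C (a _), ← h, C_C]
  have hdr : d = r • 1 := ContinuousLinearMap.ext fun y => by
    rw [hd]
    simp
  rw [hdr, blockEnd_smul_one]
  exact Algebra.mem_bot.2 ⟨r, Algebra.algebraMap_eq_smul_one r⟩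

/-! ### The spin group of signature `(9, 1)` -/

/-- The vectors of `ℝ^(9,1)` as symmetric operators on `𝕆²`. -/
def vectorOp : (Fin 9 ⊕ Fin 1 → ℝ) →L[ℝ] End2 :=
  LinearMap.toContinuousLinearMap ((hermOp : Herm2 →ₗ[ℝ] End2) ∘ₗ hermEquiv.toLinearEquiv)

theorem vectorOp_apply (v : Fin 9 ⊕ Fin 1 → ℝ) : vectorOp v = hermOp (hermEquiv v) := rfl

theorem range_vectorOp : Set.range vectorOp = Set.range hermOp :=
  hermEquiv.toLinearEquiv.surjective.range_comp hermOp

theorem isChiralPair_vectorOp : IsChiralPair (signatureForm 9 1)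
    (vectorOp : (Fin 9 ⊕ Fin 1 → ℝ) →ₗ[ℝ] End2)
    (((hermOp : Herm2 →ₗ[ℝ] End2) ∘ₗ hermDual) ∘ₗ hermEquiv.toLinearEquiv) :=
  isChiralPair_hermOp.comp_isometryEquiv hermEquiv

theorem lieAlgebraOf_range_halfSpin_eq_spin91 :
    lieAlgebraOf isChiralPair_vectorOp.halfSpin.range = spin91 := by
  have hone : 1 ∈ Set.range vectorOp := by
    rw [range_vectorOp]
    exact ⟨_, hermOp_one_one_zero⟩
  have hcentral : Subalgebra.centralizer ℝ (Set.range vectorOp) = ⊥ := by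
    rw [range_vectorOp, centralizer_range_hermOp]
  calc lieAlgebraOf isChiralPair_vectorOp.halfSpin.range
      = lieAlgebraOf (congruenceGroup (𝔸 := End2) vectorOp (signatureForm 9 1)) :=
        isChiralPair_vectorOp.lieAlgebraOf_range_halfSpin (Pi.basisFun ℝ _).span_eq
          signatureForm_basisFun_ne_zero pairwise_polar_signatureForm_basisFun hone hcentral
    _ = lieAlgebraOf (congruenceGroup (𝔸 := End2) hermOp hermForm) :=
        congrArg lieAlgebraOf (congruenceGroup_comp_isometryEquiv hermEquiv vectorOp_apply)
    _ = congruenceLieAlgebra (𝔸 := End2) hermOp hermForm :=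
        lieAlgebraOf_congruenceGroup hermOp_injective
    _ = spin91 := spin91_eq_congruenceLieAlgebra.symm

theorem isFaithfulRep_halfSpin :
    IsFaithfulRepWithLieAlgebraSpin91 isChiralPair_vectorOp.halfSpin where
  continuous := isChiralPair_vectorOp.continuous_halfSpin
  faithful :=
    have : Nontrivial End2 := hermOp_injective.nontrivial
    isChiralPair_vectorOp.halfSpin_injective (Pi.basisFun ℝ _)
      (polarBilin_surjective_of_orthogonal _ signatureForm_basisFun_ne_zero
        pairwise_polar_signatureForm_basisFun)
      (hermOp_injective.comp hermEquiv.injective)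
  lieAlgebra_eq := lieAlgebraOf_range_halfSpin_eq_spin91

/-! ### Transitivity on nonzero vectors -/

section Transitivity

variable {G : Subgroup GLOctonion2}

theorem orbit_add_apply_of_mul_self_eq_zero {N : End2} (hN : N ∈ lieAlgebraOf G)
    (hNN : N * N = 0) (x : Octonion2) : MulAction.orbit G (x + N x) = MulAction.orbit G x := by
  obtain ⟨g, hg, hexp⟩ := hN 1
  rw [one_smul, exp_eq_one_add_of_mul_self_eq_zero hNN] at hexp
  refine MulAction.orbit_eq_iff.2 ⟨⟨g, hg⟩, ?_⟩
  change (g : End2) x = x + N x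
  rw [hexp]
  rfl

variable (hG : spin91 ⊆ lieAlgebraOf G)
include hG

theorem orbit_mk_eq_of_snd_ne_zero {v : Octonion} (hv : v ≠ 0) (u u' : Octonion) :
    MulAction.orbit G ((u, v) : Octonion2) = MulAction.orbit G ((u', v) : Octonion2) := by
  obtain ⟨w, hw⟩ := exists_C_mul_eq_of_left_ne_zero hv (u - u')
  have hmem : blockEnd 0 (C.comp (R w)) 0 0 ∈ spin91 := by
    rw [spin91_eq_congruenceLieAlgebra]
    exact blockEnd_upper_mem_congruenceLieAlgebra w
  convert orbit_add_apply_of_mul_self_eq_zero (hG hmem)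
    (by simp [blockEnd_mul, blockEnd_zero]) (u', v) using 2
  simp [hw]

theorem orbit_mk_eq_of_fst_ne_zero {u : Octonion} (hu : u ≠ 0) (v v' : Octonion) :
    MulAction.orbit G ((u, v) : Octonion2) = MulAction.orbit G ((u, v') : Octonion2) := by
  obtain ⟨w, hw⟩ := exists_C_mul_eq_of_right_ne_zero hu (v - v')
  have hmem : blockEnd 0 0 (C.comp (L w)) 0 ∈ spin91 := by
    rw [spin91_eq_congruenceLieAlgebra]
    exact blockEnd_lower_mem_congruenceLieAlgebra w
  convert orbit_add_apply_of_mul_self_eq_zero (hG hmem)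
    (by simp [blockEnd_mul, blockEnd_zero]) (u, v') using 2
  simp [hw]

theorem orbit_eq_orbit_one_one {x : Octonion2} (hx : x ≠ 0) :
    MulAction.orbit G x = MulAction.orbit G ((1, 1) : Octonion2) := by
  obtain ⟨u, v⟩ := x
  by_cases hv : v = 0
  · have hu : u ≠ 0 := fun hu => hx (by rw [hu, hv]; rfl)
    rw [orbit_mk_eq_of_fst_ne_zero hG hu v 1, orbit_mk_eq_of_snd_ne_zero hG one_ne_zero u 1]
  · rw [orbit_mk_eq_of_snd_ne_zero hG hv u 1, orbit_mk_eq_of_fst_ne_zero hG one_ne_zero v 1]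

theorem orbit_eq_setOf_ne_zero {x : Octonion2} (hx : x ≠ 0) :
    MulAction.orbit G x = {y | y ≠ 0} := by
  ext y
  refine ⟨?_, fun hy => ?_⟩
  · rintro ⟨g, rfl⟩
    exact (smul_ne_zero_iff_ne g).2 hx
  · rw [← MulAction.orbit_eq_iff, orbit_eq_orbit_one_one hG hx, orbit_eq_orbit_one_one hG hy]

theorem range_orbit_eq :
    Set.range (fun x : Octonion2 => MulAction.orbit G x) = {{0}, {x | x ≠ 0}} := by
  have hzero : MulAction.orbit G (0 : Octonion2) = {0} := by
    simp only [MulAction.orbit, smul_zero, Set.range_const]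
  ext s
  constructor
  · rintro ⟨x, rfl⟩
    by_cases hx : x = 0
    · exact .inl (hx ▸ hzero)
    · exact .inr (orbit_eq_setOf_ne_zero hG hx)
  · rintro (rfl | rfl)
    · exact ⟨0, hzero⟩
    · exact ⟨(1, 0), orbit_eq_setOf_ne_zero hG fun h => one_ne_zero (congrArg Prod.fst h)⟩

end Transitivity

theorem mainTheorem7_general :
    (∃ S : Submodule ℝ End2, (S : Set End2) = spin91 ∧
      (∀ A ∈ S, ∀ B ∈ S, A * B - B * A ∈ S) ∧
      ∀ A ∈ S, LinearMap.trace ℝ Octonion2 (A : Octonion2 →ₗ[ℝ] Octonion2) = 0) ∧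
    (∃ ρ : Spin 9 1 →* GLOctonion2, IsFaithfulRepWithLieAlgebraSpin91 ρ) ∧
    ∀ {G : Type*} [Group G] (ρ : G →* GLOctonion2), spin91 ⊆ lieAlgebraOf ρ.range →
      Set.range (fun v : Octonion2 => Set.range fun g : G => (ρ g : End2) v) =
        {{0}, {v | v ≠ 0}} := by
  let S := congruenceLieAlgebra (𝔸 := End2) hermOp hermForm
  refine ⟨⟨S.toSubmodule, spin91_eq_congruenceLieAlgebra.symm,
    fun A hA B hB => S.lie_mem hA hB, fun A hA => ?_⟩,
    ⟨_, isFaithfulRep_halfSpin⟩, fun ρ hρ => ?_⟩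
  · refine trace_eq_zero_of_mem_spin91 ?_
    rwa [spin91_eq_congruenceLieAlgebra]
  · rw [← range_orbit_eq hρ]
    exact congrArg Set.range (funext fun v =>
      (ρ.rangeRestrict_surjective.range_comp fun g : ρ.range => g • v))

end

theorem mainTheorem7 :
    (∃ S : Submodule ℝ (Octonion2 →L[ℝ] Octonion2),
      (S : Set (Octonion2 →L[ℝ] Octonion2)) = spin91 ∧
      (∀ A ∈ S, ∀ B ∈ S, A * B - B * A ∈ S) ∧
      ∀ A ∈ S, LinearMap.trace ℝ Octonion2 (A : Octonion2 →ₗ[ℝ] Octonion2) = 0) ∧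
    (∃ ρ : Spin 9 1 →* GLOctonion2, IsFaithfulRepWithLieAlgebraSpin91 ρ) ∧
    ∀ ρ : Spin 9 1 →* GLOctonion2, IsFaithfulRepWithLieAlgebraSpin91 ρ →
      Set.range (fun v : Octonion2 =>
          Set.range (fun g : Spin 9 1 => (ρ g : Octonion2 →L[ℝ] Octonion2) v)) =
        {{0}, {v : Octonion2 | v ≠ 0}} := by
  obtain ⟨hlie, hfaithful, horbits⟩ := mainTheorem7_general
  exact ⟨hlie, hfaithful, fun ρ hρ => horbits ρ hρ.lieAlgebra_eq.ge⟩
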